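/- Let $n\ge 0$ and $m\ge 1$ be integers. A crossingless matching on $n$ strands is a partition of $n$ bottom points and $n$ top points on the boundary of a horizontal strip into pairs which can be joined by pairwise disjoint strands inside the strip. A strand joining two bottom points is a cap, a strand joining two top points is a cup, and a strand joining a bottom point to a top point is a through strand. The bottom half of a matching consists of its caps and the bottom ends of its through strands, and the top half consists of its cups and the top ends of its through strands. Let $m\mathcal{TL}_n$ be the $m$-cyclic Temperley--Lieb monoid. Its elements are the pairs $(a,i)$ with $a$ a crossingless matching on $n$ strands and $i\in\mathbb{Z}/m\mathbb{Z}$ (the number of internal circles modulo $m$), and its multiplication is $(a,i)(b,j)=(ab,\,i+j+\Phi(a,b))$, where $ab$ is obtained by gluing $a$ on top of $b$ and removing the closed components, and $\Phi(a,b)$ is the number of closed components removed. Write $\mathcal{TL}_n=1\mathcal{TL}_n$ for the Temperley--Lieb monoid. In a monoid put $a\le_l b$ if $b=ca$ for some $c$, $a\le_r b$ if $b=ac$ for some $c$, and $a\le_{lr}b$ if $b=cad$ for some $c,d$. Write $a\sim b$ if $a\le b$ and $b\le a$, and $a<b$ if $a\le b$ and $b\not\le a$, for each of these orders. The left, right and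 $J$-cells are the equivalence classes of $\sim_l$, $\sim_r$ and $\sim_{lr}$. The $H$-cells are the nonempty intersections of a left cell with a right cell. A cell is idempotent if it contains an idempotent, and a monoid is regular if all its $J$-cells are idempotent. For $0\le k\le n$ with $k\equiv n \pmod 2$ let $c(k)=(n-k)/2$, and let $\mathcal{J}_k\subseteq m\mathcal{TL}_n$ be the set of elements with exactly $k$ through strands. Then the following hold. 0. $m\mathcal{TL}_n$ has the cell structure of $\mathcal{TL}_n$ with each $H$-cell inflated to size $m$: for each of the orders $\le_l,\le_r,\le_{lr}$ one has $(a,i)\le(b,j)$ in $m\mathcal{TL}_n$ if and only if $a\le b$ in $\mathcal{TL}_n$, and the $H$-cells of $m\mathcal{TL}_n$ are exactly the sets $\{(a,i)\mid i\in\mathbb{Z}/m\mathbb{Z}\}$, which have $m$ elements. 1. Two elements lie in the same left cell if and only if they have the same bottom half, and in the same right cell if and only if they have the same top half. 2. The $J$-cells are exactly the sets $\mathcal{J}_k$ with $0\le k\le n$ and $k\equiv n\pmod 2$. 3. The orders increase as the number of through strands decreases: if $x\le_l y$ or $x\le_r y$, then $y$ has at most as many through strands as $x$, and strictly fewer if $x<_l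 y$ or $x<_r y$ respectively. Moreover, $x\le_{lr}y$ if and only if $y$ has at most as many through strands as $x$. In particular, $\le_{lr}$ induces a total order on the set of $J$-cells. 4. Every left cell $\mathcal{L}\subseteq\mathcal{J}_k$ and every right cell $\mathcal{R}\subseteq\mathcal{J}_k$ satisfies $$|\mathcal{L}|=|\mathcal{R}|=m\left(\frac{k+1}{n-c(k)+1}\right)\binom{n}{c(k)}.$$ 5. For every left cell $\mathcal{L}\subseteq\mathcal{J}_k$ one has $|\mathcal{J}_k|=|\mathcal{L}|^2/m$. 6. Every $J$-cell is idempotent, i.e. $m\mathcal{TL}_n$ is regular. 7. Every idempotent $H$-cell is, under the multiplication of $m\mathcal{TL}_n$, a cyclic group of order $m$. -/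

import Mathlib

namespace TemperleyLieb

/-- The `2n` boundary points of a diagram: `Sum.inl i` is the `i`-th bottom point and
`Sum.inr i` is the `i`-th top point, both counted from the left. -/
abbrev Pt (n : ℕ) : Type := Fin n ⊕ Fin n

/-- Position of a boundary point when the boundary of the strip is traversed along the bottom
from left to right and then along the top from right to left. -/
def pos {n : ℕ} : Pt n → ℕ :=
  Sum.elim (fun i => (i : ℕ)) (fun i => n + (i.rev : ℕ))

/-- The conditions on an equivalence relation on the boundary points to be the relation "is an
endpoint of the same strand" of a crossingless matching: every point is joined to exactly one
other point, and no two strands cross. -/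
structure IsCrossinglessMatching {n : ℕ} (r : Setoid (Pt n)) : Prop where
  existsUnique_mate : ∀ p, ∃! q, q ≠ p ∧ r p q
  noncrossing : ∀ p q p' q', pos p < pos q → pos q < pos p' → pos p' < pos q' →
    r p p' → r q q' → False

/-- Crossingless matchings without internal components from `n` points to `n` points, up to
equivalence, given as partitions of the `2n` boundary points into pairs. -/
@[ext]
structure Diagram (n : ℕ) where
  rel : Setoid (Pt n)
  isCrossingless : IsCrossinglessMatching rel

/-- The points of two diagrams glued on top of each other: three rows of `n` points each,
row `0` at the bottom, row `1` in the middle and row `2` at the top. -/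
abbrev GluePt (n : ℕ) : Type := Fin 3 × Fin n

/-- The boundary points of the lower diagram among the glued points. -/
def lower {n : ℕ} : Pt n → GluePt n := Sum.elim (fun i => (0, i)) (fun i => (1, i))

/-- The boundary points of the upper diagram among the glued points. -/
def upper {n : ℕ} : Pt n → GluePt n := Sum.elim (fun i => (1, i)) (fun i => (2, i))

/-- The boundary points of the composite diagram among the glued points. -/
def outer {n : ℕ} : Pt n → GluePt n := Sum.elim (fun i => (0, i)) (fun i => (2, i))

/-- The relation "lies in the same connected component" on the points of the diagram obtained by
gluing `a` on top of `b`: the equivalence relation generated by the strands of `b` (between the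
rows `0` and `1`) and the strands of `a` (between the rows `1` and `2`). -/
def glue {n : ℕ} (a b : Setoid (Pt n)) : Setoid (GluePt n) :=
  b.map lower ⊔ a.map upper

/-- The number of connected components that contain none of the points `o p`. -/
noncomputable def internalCount {V P : Type} (g : Setoid V) (o : P → V) : ℕ :=
  Nat.card {c : Quotient g // ∀ p, c ≠ Quotient.mk g (o p)}

/-- The number of internal components created by gluing `a` on top of `b`. -/
noncomputable def Phi {n : ℕ} (a b : Diagram n) : ℕ :=
  internalCount (glue a.rel b.rel) outer

theorem le_iff {V : Type} {r s : Setoid V} : r ≤ s ↔ ∀ x y, r x y → s x y := Iff.rfl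

theorem map_le {V W : Type} {r : Setoid V} {f : V → W} {s : Setoid W} :
    r.map f ≤ s ↔ r ≤ s.comap f := by
  constructor
  · intro h x y hxy
    exact h (Relation.EqvGen.rel _ _ ⟨x, y, hxy, rfl, rfl⟩)
  · intro h
    apply Setoid.eqvGen_le
    rintro _ _ ⟨x, y, hxy, rfl, rfl⟩
    exact h hxy

theorem map_mk {V W : Type} {r : Setoid V} (f : V → W) {x y : V} (h : r x y) :
    r.map f (f x) (f y) :=
  Relation.EqvGen.rel _ _ ⟨x, y, h, rfl, rfl⟩

theorem map_iff {V W : Type} {r : Setoid V} {f : V → W} (hf : Function.Injective f) {u v : W} :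
    r.map f u v ↔ u = v ∨ ∃ x y, u = f x ∧ v = f y ∧ r x y := by
  have h := Setoid.coe_map_of_ker_le r f (by
    intro x y hxy
    have hh : f x = f y := hxy
    rw [hf hh])
  rw [h]
  constructor
  · rintro (⟨x, y, hxy, rfl, rfl⟩ | h)
    · exact Or.inr ⟨x, y, rfl, rfl, hxy⟩
    · exact Or.inl h
  · rintro (h | ⟨x, y, rfl, rfl, hxy⟩)
    · exact Or.inr h
    · exact Or.inl ⟨x, y, hxy, rfl, rfl⟩

theorem map_map {V W X : Type} (r : Setoid V) (f : V → W) (g : W → X) :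
    (r.map f).map g = r.map (g ∘ f) :=
  le_antisymm
    (map_le.2 (map_le.2 fun _ _ h => map_mk (g ∘ f) h))
    (map_le.2 fun _ _ h => map_mk g (map_mk f h))

theorem map_sup {V W : Type} (r s : Setoid V) (f : V → W) :
    (r ⊔ s).map f = r.map f ⊔ s.map f := by
  apply le_antisymm
  · exact map_le.2 (sup_le (map_le.1 le_sup_left) (map_le.1 le_sup_right))
  · exact sup_le (map_le.2 fun _ _ h => map_mk f (le_sup_left (a := r) h))
      (map_le.2 fun _ _ h => map_mk f (le_sup_right (a := r) h))

/-- Gluing in two steps: connected components of the full picture seen on a part. -/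
theorem comap_two_step {P V W : Type} (G : Setoid V) (o : P → V) (r : Setoid P)
    (i j : V → W) (hi : Function.Injective i) (hj : Function.Injective j) (s t : P → V)
    (hos : ∀ p, i (o p) = j (s p))
    (hmeet : ∀ u x, i u = j x → ∃ p, u = o p ∧ x = s p) :
    (G.map i ⊔ r.map (j ∘ t)).comap j = (G.comap o).map s ⊔ r.map t := by
  apply le_antisymm
  · -- a candidate relation on `W`
    intro x y hxy
    let E := (G.comap o).map s ⊔ r.map t
    have hsG : ∀ p q, G (o p) (o q) → E (s p) (s q) := fun p q h =>
      le_sup_left (a := (G.comap o).map s) (map_mk s (r := G.comap o) h)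
    -- relation on W: generated by E on range j, extended along G
    let R : Setoid W :=
      { r := fun u v =>
          (∃ x y, (G.map i) u (j x) ∧ (G.map i) v (j y) ∧ E x y) ∨ (G.map i) u v
        iseqv := by
          have key : ∀ x y, (G.map i) (j x) (j y) → E x y := by
            intro x y h
            rcases (map_iff hi).1 h with h | ⟨a, b, ha, hb, hab⟩
            · rw [hj h]
            · obtain ⟨p, rfl, rfl⟩ := hmeet a x ha.symm
              obtain ⟨q, rfl, rfl⟩ := hmeet b y hb.symm
              exact hsG p q hab
          refine ⟨fun u => Or.inr ((G.map i).refl u), ?_, ?_⟩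
          · rintro u v (⟨x, y, hu, hv, h⟩ | h)
            · exact Or.inl ⟨y, x, hv, hu, E.symm h⟩
            · exact Or.inr ((G.map i).symm h)
          · rintro u v w (⟨x, y, hu, hv, h⟩ | h) (⟨x', y', hu', hv', h'⟩ | h')
            · exact Or.inl ⟨x, y', hu, hv',
                E.trans h (E.trans (key _ _ ((G.map i).trans ((G.map i).symm hv) hu')) h')⟩
            · exact Or.inl ⟨x, y, hu, (G.map i).trans ((G.map i).symm h') hv, h⟩
            · exact Or.inl ⟨x', y', (G.map i).trans h hu', hv', h'⟩
            · exact Or.inr ((G.map i).trans h h') }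
    have hR : G.map i ⊔ r.map (j ∘ t) ≤ R := by
      refine sup_le (fun u v h => Or.inr h) (map_le.2 fun p q h => Or.inl ?_)
      exact ⟨t p, t q, (G.map i).refl _, (G.map i).refl _,
        le_sup_right (a := (G.comap o).map s) (map_mk t h)⟩
    have key : ∀ x y, (G.map i) (j x) (j y) → E x y := by
      intro x y h
      rcases (map_iff hi).1 h with h | ⟨a, b, ha, hb, hab⟩
      · rw [hj h]
      · obtain ⟨p, rfl, rfl⟩ := hmeet a x ha.symm
        obtain ⟨q, rfl, rfl⟩ := hmeet b y hb.symm
        exact hsG p q hab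
    rcases hR hxy with ⟨x', y', hx, hy, h⟩ | h
    · exact E.trans (key _ _ hx) (E.trans h (E.symm (key _ _ hy)))
    · exact key _ _ h
  · refine sup_le (map_le.2 fun p q h => ?_) (map_le.2 fun p q h => ?_)
    · change (G.map i ⊔ r.map (j ∘ t)) (j (s p)) (j (s q))
      rw [← hos, ← hos]
      exact le_sup_left (a := G.map i) (map_mk i h)
    · exact le_sup_right (a := G.map i) (map_mk (j ∘ t) h)

theorem internalCount_two_step {P V W : Type} [Finite V] [Finite W]
    (G : Setoid V) (o : P → V) (r : Setoid P)
    (i j : V → W) (hi : Function.Injective i) (s t o' : P → V)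
    (hos : ∀ p, i (o p) = j (s p))
    (hmeet : ∀ u x, i u = j x → ∃ p, u = o p ∧ x = s p)
    (hcov : ∀ w, (∃ u, i u = w) ∨ (∃ x, j x = w)) :
    internalCount (G.map i ⊔ r.map (j ∘ t)) (j ∘ o') =
      internalCount G o + internalCount ((G.map i ⊔ r.map (j ∘ t)).comap j) o' := by
  set T := G.map i ⊔ r.map (j ∘ t) with hT
  have hGT : ∀ {u v}, G u v → T (i u) (i v) := fun h =>
    le_sup_left (a := G.map i) (map_mk i h)
  have F1 : ∀ u, (∀ p, ¬ G u (o p)) → ∀ w, T (i u) w → ∃ u', w = i u' ∧ G u u' := by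
    intro u hu w hw
    have hle : T ≤ Setoid.ker (fun w => ∃ u', w = i u' ∧ G u u') := by
      refine sup_le (map_le.2 fun a b h => ?_) (map_le.2 fun p q _ => ?_)
      · apply propext
        constructor
        · rintro ⟨u', h1, h2⟩
          exact ⟨b, rfl, G.trans (hi h1 ▸ h2) h⟩
        · rintro ⟨u', h1, h2⟩
          exact ⟨a, rfl, G.trans (hi h1 ▸ h2) (G.symm h)⟩
      · have no : ∀ p, ¬ ∃ u', (j ∘ t) p = i u' ∧ G u u' := by
          rintro p ⟨u', h1, h2⟩
          obtain ⟨p', rfl, _⟩ := hmeet u' (t p) h1.symm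
          exact hu p' h2
        exact propext (iff_of_false (no p) (no q))
    have hh : (∃ u', i u = i u' ∧ G u u') = (∃ u', w = i u' ∧ G u u') := hle hw
    rw [← hh]
    exact ⟨u, rfl, G.refl u⟩
  have F2 : ∀ u, (∀ p, ¬ G u (o p)) → ∀ x, ¬ T (i u) (j x) := by
    intro u hu x h
    obtain ⟨u', h1, h2⟩ := F1 u hu _ h
    obtain ⟨p, rfl, _⟩ := hmeet u' x h1.symm
    exact hu p h2
  let f1 : Quotient G → Quotient T := Quotient.map i fun _ _ h => hGT h
  let f2 : Quotient (T.comap j) → Quotient T := Quotient.map j fun _ _ h => h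
  let f : {c : Quotient G // ∀ p, c ≠ Quotient.mk G (o p)} ⊕
      {c : Quotient (T.comap j) // ∀ p, c ≠ Quotient.mk (T.comap j) (o' p)} →
      {c : Quotient T // ∀ p, c ≠ Quotient.mk T ((j ∘ o') p)} :=
    Sum.elim
      (fun c => ⟨f1 c.1, by
        obtain ⟨c, hc⟩ := c
        induction c using Quotient.inductionOn with
        | h u =>
          intro p h
          exact F2 u (fun p h => hc p (Quotient.sound h)) _ (Quotient.exact h)⟩)
      (fun c => ⟨f2 c.1, by
        obtain ⟨c, hc⟩ := c
        induction c using Quotient.inductionOn with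
        | h x =>
          intro p h
          have h' : T (j x) (j (o' p)) := Quotient.exact h
          exact hc p (Quotient.sound h')⟩)
  have hf : Function.Bijective f := by
    constructor
    · rintro (⟨c, hc⟩ | ⟨c, hc⟩) (⟨d, hd⟩ | ⟨d, hd⟩) h
      all_goals
        obtain ⟨u, rfl⟩ := Quotient.exists_rep c
        obtain ⟨v, rfl⟩ := Quotient.exists_rep d
        have h' := Subtype.ext_iff.1 h
      · have h'' : T (i u) (i v) := Quotient.exact h'
        obtain ⟨u', h1, h2⟩ := F1 u (fun p h => hc p (Quotient.sound h)) _ h''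
        have : G u v := by rw [hi h1]; exact h2
        congr 2
        exact Quotient.sound this
      · have h'' : T (i u) (j v) := Quotient.exact h'
        exact (F2 u (fun p h => hc p (Quotient.sound h)) _ h'').elim
      · have h'' : T (j u) (i v) := Quotient.exact h'
        exact (F2 v (fun p h => hd p (Quotient.sound h)) _ (T.symm h'')).elim
      · have h'' : T (j u) (j v) := Quotient.exact h'
        congr 2
        exact Quotient.sound h''
    · rintro ⟨c, hc⟩
      induction c using Quotient.inductionOn with
      | h w =>
      have onj : ∀ x, T w (j x) → ∃ a, f a = ⟨Quotient.mk T w, hc⟩ := by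
        intro x hx
        refine ⟨Sum.inr ⟨Quotient.mk _ x, fun p h => ?_⟩, ?_⟩
        · have h' : T (j x) (j (o' p)) := Quotient.exact (s := T.comap j) h
          exact hc p (Quotient.sound (T.trans hx h'))
        · apply Subtype.ext
          exact Quotient.sound (T.symm hx)
      rcases hcov w with ⟨u, rfl⟩ | ⟨x, rfl⟩
      · by_cases hu : ∀ p, ¬ G u (o p)
        · exact ⟨Sum.inl ⟨Quotient.mk _ u, fun p h => hu p (Quotient.exact h)⟩, rfl⟩
        · push Not at hu
          obtain ⟨p, hp⟩ := hu
          apply onj (s p)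
          rw [← hos]
          exact hGT hp
      · exact onj x (T.refl _)
  unfold internalCount
  rw [← Nat.card_congr (Equiv.ofBijective f hf), Nat.card_sum]

theorem existsUnique_other_end {V : Type} [Finite V] (α β : Equiv.Perm V)
    (hα : ∀ v, α (α v) = v) (hβ : ∀ v, β (β v) = v) (hdis : ∀ v, α v = v → β v ≠ v)
    (E : Setoid V) (hEα : ∀ v, E v (α v)) (hEβ : ∀ v, E v (β v))
    (hmin : ∀ T : Set V, (∀ v ∈ T, α v ∈ T) → (∀ v ∈ T, β v ∈ T) →
      ∀ p q, E p q → p ∈ T → q ∈ T)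
    (p : V) (hp : β p = p) :
    ∃! q, q ≠ p ∧ (α q = q ∨ β q = q) ∧ E p q := by
  let ρ : Equiv.Perm V := α * β
  have hβρ : ∀ k : ℤ, β ((ρ ^ k) p) = (ρ ^ (-k)) p := by
    have h1 : β * ρ * β⁻¹ = ρ⁻¹ := by
      ext v
      have : β⁻¹ = β := by ext v; rw [Equiv.Perm.inv_eq_iff_eq, hβ]
      have h2 : α⁻¹ = α := by ext v; rw [Equiv.Perm.inv_eq_iff_eq, hα]
      simp [ρ, this, h2, hβ]
    intro k
    have h2 : β * ρ ^ k * β⁻¹ = ρ ^ (-k) := by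
      rw [← conj_zpow, h1, inv_zpow, zpow_neg]
    rw [← h2]
    have h3 : β⁻¹ p = p := by rw [Equiv.Perm.inv_eq_iff_eq, hp]
    rw [Equiv.Perm.mul_apply, Equiv.Perm.mul_apply, h3]
  have hαρ : ∀ k : ℤ, α ((ρ ^ k) p) = (ρ ^ (1 - k)) p := by
    intro k
    have : α ((ρ ^ k) p) = ρ (β ((ρ ^ k) p)) := by simp [ρ, hβ]
    rw [this, hβρ, sub_eq_add_neg, zpow_add, zpow_one]; rfl
  have hEρ : ∀ k : ℤ, E p ((ρ ^ k) p) := by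
    have step : ∀ v, E v (ρ v) := fun v => E.trans (hEβ v) (hEα _)
    intro k
    induction k using Int.induction_on with
    | zero => exact E.refl _
    | succ k ih =>
      rw [add_comm, zpow_add, zpow_one]
      exact E.trans ih (step _)
    | pred k ih =>
      refine E.trans ih (E.symm ?_)
      have := step ((ρ ^ (-(k : ℤ) - 1)) p)
      rwa [← Equiv.Perm.mul_apply, ← zpow_one_add, show (1 : ℤ) + (-(k : ℤ) - 1) = -k by ring]
        at this
  have horb : ∀ q, E p q → ∃ k : ℤ, q = (ρ ^ k) p := by
    intro q hq
    refine hmin {v | ∃ k : ℤ, v = (ρ ^ k) p} ?_ ?_ p q hq ⟨0, rfl⟩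
    · rintro _ ⟨k, rfl⟩; exact ⟨_, hαρ k⟩
    · rintro _ ⟨k, rfl⟩; exact ⟨_, hβρ k⟩
  let N : ℤ := Function.minimalPeriod (ρ • ·) p
  have hN : ∀ k : ℤ, (ρ ^ k) p = p ↔ N ∣ k := fun k =>
    MulAction.zpow_smul_eq_iff_minimalPeriod_dvd (a := ρ) (b := p)
  have hN2 : ∀ k l : ℤ, (ρ ^ k) p = (ρ ^ l) p ↔ N ∣ k - l := by
    intro k l
    rw [← hN, sub_eq_neg_add, zpow_add, zpow_neg, Equiv.Perm.mul_apply,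
      Equiv.Perm.inv_eq_iff_eq]
  have hNpos : 0 < N := by
    have : 0 < Function.minimalPeriod (ρ • ·) p := by
      apply Function.minimalPeriod_pos_of_mem_periodicPts
      obtain ⟨k, hk, h⟩ := (isOfFinOrder_of_finite ρ).exists_pow_eq_one
      refine ⟨k, hk, ?_⟩
      have h2 : (ρ ^ k) p = p := by rw [h]; rfl
      rw [Function.IsPeriodicPt, Function.IsFixedPt, smul_iterate]
      exact h2
    exact Int.natCast_pos.2 this
  have hfix : ∀ k : ℤ, (α ((ρ ^ k) p) = (ρ ^ k) p ∨ β ((ρ ^ k) p) = (ρ ^ k) p) ↔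
      (N ∣ 1 - 2 * k ∨ N ∣ 2 * k) := by
    intro k
    rw [hαρ, hβρ, hN2, hN2, show 1 - k - k = 1 - 2 * k by ring,
      show - k - k = -(2 * k) by ring, dvd_neg]
  have hN1 : N ≠ 1 := by
    intro h
    have h1 : (ρ ^ (1 : ℤ)) p = p := by rw [hN, h]
    have : α p = p := by
      have h2 : ρ p = p := by simpa using h1
      simpa [ρ, hp] using h2
    exact hdis p this hp
  obtain ⟨M, hM | hM⟩ := Int.even_or_odd' N
  · refine ⟨(ρ ^ M) p, ⟨?_, ?_, hEρ _⟩, ?_⟩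
    · rw [Ne, hN]; intro h
      have := Int.le_of_dvd (by omega) h
      omega
    · rw [hfix]; right; rw [hM]
    · rintro q ⟨h1, h2, h3⟩
      obtain ⟨k, rfl⟩ := horb q h3
      rw [Ne, hN] at h1
      rw [hfix] at h2
      rw [hN2]
      rcases h2 with ⟨c, hc⟩ | ⟨c, hc⟩
      · exfalso
        rw [hM, mul_assoc] at hc
        omega
      · have hk : k = M * c := by
          rw [hM, mul_assoc] at hc; omega
        obtain ⟨d, hd | hd⟩ := Int.even_or_odd' c
        · exfalso; apply h1; exact ⟨d, by rw [hk, hM, hd]; ring⟩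
        · exact ⟨d, by rw [hk, hM, hd]; ring⟩
  · refine ⟨(ρ ^ (M + 1)) p, ⟨?_, ?_, hEρ _⟩, ?_⟩
    · rw [Ne, hN]; intro h
      have := Int.le_of_dvd (by omega) h
      omega
    · rw [hfix]; left; exact ⟨-1, by rw [hM]; ring⟩
    · rintro q ⟨h1, h2, h3⟩
      obtain ⟨k, rfl⟩ := horb q h3
      rw [Ne, hN] at h1
      rw [hfix] at h2
      have hcop : IsCoprime N 2 := ⟨1, -M, by rw [hM]; ring⟩
      rw [hN2]
      rcases h2 with h | h
      · refine hcop.dvd_of_dvd_mul_left ?_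
        have : 2 * (k - (M + 1)) = -(1 - 2 * k) - N := by rw [hM]; ring
        rw [this]
        exact dvd_sub (dvd_neg.2 h) dvd_rfl
      · exact (h1 (hcop.dvd_of_dvd_mul_left h)).elim

theorem lower_injective {n : ℕ} : Function.Injective (lower (n := n)) := by
  rintro (p | p) (q | q) h <;> simp_all [lower]

theorem upper_injective {n : ℕ} : Function.Injective (upper (n := n)) := by
  rintro (p | p) (q | q) h <;> simp_all [upper]

theorem outer_injective {n : ℕ} : Function.Injective (outer (n := n)) := by
  rintro (p | p) (q | q) h <;> simp_all [outer]

theorem pos_injective {n : ℕ} : Function.Injective (pos (n := n)) := by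
  rintro (p | p) (q | q) h <;> simp [pos, Fin.ext_iff] at h ⊢ <;> omega

theorem exists_mate {n : ℕ} {r : Setoid (Pt n)} (h : ∀ p, ∃! q, q ≠ p ∧ r p q) :
    ∃ f : Pt n → Pt n, (∀ p, f (f p) = p) ∧ (∀ p, f p ≠ p) ∧ (∀ p, r p (f p)) ∧
      (∀ p q, r p q → q = p ∨ q = f p) := by
  choose f hf hf' using h
  refine ⟨f, fun p => ?_, fun p => (hf p).1, fun p => (hf p).2, fun p q hq => ?_⟩
  · exact (hf' (f p) p ⟨(hf p).1.symm, r.symm (hf p).2⟩).symm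
  · by_cases hqp : q = p
    · exact Or.inl hqp
    · exact Or.inr (hf' p q ⟨hqp, hq⟩)

theorem comp_existsUnique {n : ℕ} {a b : Setoid (Pt n)}
    (ha : ∀ p, ∃! q, q ≠ p ∧ a p q) (hb : ∀ p, ∃! q, q ≠ p ∧ b p q) (p : Pt n) :
    ∃! q, q ≠ p ∧ (glue a b).comap outer p q := by
  obtain ⟨f, f1, f2, f3, f4⟩ := exists_mate ha
  obtain ⟨g, g1, g2, g3, g4⟩ := exists_mate hb
  let up : GluePt n → Pt n := fun v => if v.1 = 1 then Sum.inl v.2 else Sum.inr v.2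
  let lo : GluePt n → Pt n := fun v => if v.1 = 0 then Sum.inl v.2 else Sum.inr v.2
  have hup : ∀ p, up (upper p) = p := by rintro (p | p) <;> simp [up, upper]
  have hlo : ∀ p, lo (lower p) = p := by rintro (p | p) <;> simp [lo, lower]
  have hup0 : ∀ p, (upper p : GluePt n).1 ≠ 0 := by rintro (p | p) <;> simp [upper]
  have hlo2 : ∀ p, (lower p : GluePt n).1 ≠ 2 := by rintro (p | p) <;> simp [lower]
  have hup' : ∀ v, v.1 ≠ 0 → upper (up v) = v := by
    rintro ⟨r, x⟩ h; fin_cases r <;> simp [up, upper] at h ⊢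
  have hlo' : ∀ v, v.1 ≠ 2 → lower (lo v) = v := by
    rintro ⟨r, x⟩ h; fin_cases r <;> simp [lo, lower] at h ⊢
  let α0 : GluePt n → GluePt n := fun v => if v.1 = 0 then v else upper (f (up v))
  let β0 : GluePt n → GluePt n := fun v => if v.1 = 2 then v else lower (g (lo v))
  have hα0 : Function.Involutive α0 := by
    intro v
    by_cases h : v.1 = 0
    · simp [α0, h]
    · simp [α0, h, hup0, hup, f1, hup' v h]
  have hβ0 : Function.Involutive β0 := by
    intro v
    by_cases h : v.1 = 2
    · simp [β0, h]
    · simp [β0, h, hlo2, hlo, g1, hlo' v h]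
  have fixα : ∀ v, α0 v = v ↔ v.1 = 0 := by
    intro v
    by_cases h : v.1 = 0
    · simp [α0, h]
    · simp only [α0, h, if_false, iff_false]
      intro h'
      apply f2 (up v)
      rw [← hup (f (up v)), h']
  have fixβ : ∀ v, β0 v = v ↔ v.1 = 2 := by
    intro v
    by_cases h : v.1 = 2
    · simp [β0, h]
    · simp only [β0, h, if_false, iff_false]
      intro h'
      apply g2 (lo v)
      rw [← hlo (g (lo v)), h']
  have hEα : ∀ v, glue a b v (α0 v) := by
    intro v
    by_cases h : v.1 = 0
    · simp only [α0, h, if_true]; exact (glue a b).refl v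
    · have h2 := le_sup_right (a := b.map lower) (map_mk upper (f3 (up v)))
      simp only [α0, h, if_false]
      rw [hup' v h] at h2
      exact h2
  have hEβ : ∀ v, glue a b v (β0 v) := by
    intro v
    by_cases h : v.1 = 2
    · simp only [β0, h, if_true]; exact (glue a b).refl v
    · have h2 := le_sup_left (b := a.map upper) (map_mk lower (g3 (lo v)))
      simp only [β0, h, if_false]
      rw [hlo' v h] at h2
      exact h2
  have hmin : ∀ T : Set (GluePt n), (∀ v ∈ T, α0 v ∈ T) → (∀ v ∈ T, β0 v ∈ T) →
      ∀ p q, glue a b p q → p ∈ T → q ∈ T := by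
    intro T hTα hTβ p q hpq hp
    have hle : glue a b ≤ Setoid.ker (· ∈ T) := by
      refine sup_le (map_le.2 fun x y h => ?_) (map_le.2 fun x y h => ?_)
      · apply propext
        rcases g4 x y h with rfl | rfl
        · rfl
        · have e1 : β0 (lower x) = lower (g x) := by simp [β0, hlo2, hlo]
          have e2 : β0 (lower (g x)) = lower x := by simp [β0, hlo2, hlo, g1]
          exact ⟨fun h => e1 ▸ hTβ _ h, fun h => e2 ▸ hTβ _ h⟩
      · apply propext
        rcases f4 x y h with rfl | rfl
        · rfl
        · have e1 : α0 (upper x) = upper (f x) := by simp [α0, hup0, hup]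
          have e2 : α0 (upper (f x)) = upper x := by simp [α0, hup0, hup, f1]
          exact ⟨fun h => e1 ▸ hTα _ h, fun h => e2 ▸ hTα _ h⟩
    have hh : (p ∈ T) = (q ∈ T) := hle hpq
    rw [← hh]; exact hp
  have main : ∃! q : GluePt n, q ≠ outer p ∧ (q.1 = 0 ∨ q.1 = 2) ∧ glue a b (outer p) q := by
    have hcase : (outer p : GluePt n).1 = 0 ∨ (outer p : GluePt n).1 = 2 := by
      rcases p with p | p <;> simp [outer]
    rcases hcase with h0 | h2
    · have := existsUnique_other_end hβ0.toPerm hα0.toPerm hβ0 hα0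
        (fun v h h' => by
          have h1 := (fixα v).1 h'
          have h2 := (fixβ v).1 h
          rw [h1] at h2; exact absurd h2 (by decide))
        (glue a b) hEβ hEα (fun T h h' => hmin T h' h) (outer p) ((fixα _).2 h0)
      simpa only [Function.Involutive.coe_toPerm, fixα, fixβ, or_comm] using this
    · have := existsUnique_other_end hα0.toPerm hβ0.toPerm hα0 hβ0
        (fun v h h' => by
          have h1 := (fixα v).1 h
          have h2 := (fixβ v).1 h'
          rw [h1] at h2; exact absurd h2 (by decide))
        (glue a b) hEα hEβ hmin (outer p) ((fixβ _).2 h2)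
      simpa only [Function.Involutive.coe_toPerm, fixα, fixβ] using this
  obtain ⟨q, ⟨h1, h2, h3⟩, hq⟩ := main
  have : ∃ q', outer q' = q := by
    obtain ⟨r, x⟩ := q
    rcases h2 with h2 | h2
    · exact ⟨Sum.inl x, Prod.ext h2.symm rfl⟩
    · exact ⟨Sum.inr x, Prod.ext h2.symm rfl⟩
  obtain ⟨q', rfl⟩ := this
  refine ⟨q', ⟨fun h => h1 (by rw [h]), h3⟩, ?_⟩
  rintro y ⟨y1, y2⟩
  apply outer_injective
  refine hq _ ⟨fun h => y1 (outer_injective h), ?_, y2⟩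
  rcases y with y | y <;> simp [outer]

open Classical in
theorem sum_saturated {n : ℕ} {r : Setoid (Pt n)} (h : ∀ p, ∃! q, q ≠ p ∧ r p q)
    (S : Pt n → Prop) (hS : ∀ p q, q ≠ p → r p q → S p → S q) :
    ∑ s, (if S s then (1 : ZMod 2) else 0) = 0 := by
  obtain ⟨f, f1, f2, f3, -⟩ := exists_mate h
  have hSf : ∀ s, S (f s) ↔ S s := fun s =>
    ⟨fun hs => by
      have := hS (f s) (f (f s)) (f2 _) (f3 _) hs
      rwa [f1] at this, fun hs => hS s (f s) (f2 s) (f3 s) hs⟩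
  refine Finset.sum_involution (fun s _ => f s) ?_ ?_ ?_ ?_
  · intro s _
    simp only [hSf]
    split_ifs <;> decide
  · intro s _ _; exact f2 s
  · intro s _; exact Finset.mem_univ _
  · intro s _; exact f1 s

open Classical in
/-- The parity of the number of points of `S` in the row of `p` to the left of `p`. -/
noncomputable def leftParity {n : ℕ} (S : Pt n → Prop) : Pt n → ZMod 2 :=
  Sum.elim (fun i => ∑ x : Fin n, if S (Sum.inl x) ∧ x < i then 1 else 0)
    (fun i => ∑ x : Fin n, if S (Sum.inr x) ∧ x < i then 1 else 0)

open Classical in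
theorem leftParity_eq {n : ℕ} (S : Pt n → Prop)
    (heven : ∑ s, (if S s then (1 : ZMod 2) else 0) = 0) (p : Pt n) (hp : ¬ S p) :
    leftParity S p = ∑ s, if S s ∧ pos s < pos p then 1 else 0 := by
  rw [Fintype.sum_sum_type]
  rcases p with i | i
  · have : ∀ x : Fin n, ¬ (pos (Sum.inr x) < pos (Sum.inl i)) := by
      intro x; simp [pos]; omega
    simp only [this, and_false, if_false, Finset.sum_const_zero, add_zero]
    rfl
  · have h1 : ∀ x : Fin n, pos (Sum.inl x) < pos (Sum.inr i) := by
      intro x; simp [pos]; omega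
    have h2 : ∀ x : Fin n, pos (Sum.inr x) < pos (Sum.inr i) ↔ i < x := by
      intro x; simp only [pos, Sum.elim_inr, Fin.val_rev, Fin.lt_def]; omega
    rw [Fintype.sum_sum_type] at heven
    simp only [h1, h2, and_true]
    have h3 : ∑ x : Fin n, (if S (Sum.inr x) then (1 : ZMod 2) else 0) =
        (∑ x : Fin n, if S (Sum.inr x) ∧ x < i then (1 : ZMod 2) else 0) +
        ∑ x : Fin n, if S (Sum.inr x) ∧ i < x then (1 : ZMod 2) else 0 := by
      rw [← Finset.sum_add_distrib]
      refine Finset.sum_congr rfl fun x _ => ?_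
      rcases lt_trichotomy x i with h | h | h
      · simp [h, h.not_gt]
      · subst h; simp [hp]
      · simp [h, h.not_gt]
    rw [h3] at heven
    simp only [leftParity, Sum.elim_inr]
    have hneg : ∀ x y z : ZMod 2, x + (y + z) = 0 → y = x + z := by decide
    exact hneg _ _ _ heven

open Classical in
theorem leftParity_const {n : ℕ} {r : Setoid (Pt n)} (hr : IsCrossinglessMatching r)
    (S : Pt n → Prop) (hS : ∀ p q, r p q → S p → S q) (p q : Pt n) (hpq : r p q) (hp : ¬ S p) :
    leftParity S p = leftParity S q := by
  wlog hlt : pos p < pos q generalizing p q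
  · by_cases h : p = q
    · rw [h]
    · refine (this q p (r.symm hpq) (fun h => hp (hS _ _ (r.symm hpq) h)) ?_).symm
      exact lt_of_le_of_ne (not_lt.1 hlt) fun h' => h (pos_injective h'.symm)
  have hq : ¬ S q := fun h => hp (hS _ _ (r.symm hpq) h)
  have heven := sum_saturated hr.existsUnique_mate S (fun p q _ h => hS p q h)
  rw [leftParity_eq S heven p hp, leftParity_eq S heven q hq]
  have hmid := sum_saturated hr.existsUnique_mate
    (fun s => S s ∧ pos p < pos s ∧ pos s < pos q) (by
      rintro s t hts hst ⟨h1, h2, h3⟩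
      have ht : S t := hS _ _ hst h1
      have htp : pos t ≠ pos p := fun h => hp (pos_injective h ▸ ht)
      have htq : pos t ≠ pos q := fun h => hq (pos_injective h ▸ ht)
      refine ⟨ht, ?_, ?_⟩
      · by_contra h
        exact hr.noncrossing t p s q (by omega) h2 h3 (r.symm hst) hpq
      · by_contra h
        exact hr.noncrossing p s q t h2 h3 (by omega) hpq hst)
  rw [← add_zero (∑ s, if S s ∧ pos s < pos p then (1 : ZMod 2) else 0)]
  refine (congrArg _ hmid.symm).trans ?_
  rw [← Finset.sum_add_distrib]
  refine Finset.sum_congr rfl fun s _ => ?_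
  by_cases hs : S s
  · have hsp : pos s ≠ pos p := fun h => hp (pos_injective h ▸ hs)
    by_cases h1 : pos s < pos p
    · have h2 : pos s < pos q := by omega
      simp [hs, h1, h2, h1.not_gt]
    · have h2 : pos p < pos s := by omega
      simp [hs, h1, h2]
  · simp [hs]

open Classical in
theorem comp_noncrossing {n : ℕ} {a b : Setoid (Pt n)} (ha : IsCrossinglessMatching a)
    (hb : IsCrossinglessMatching b) (p q p' q' : Pt n) (h1 : pos p < pos q)
    (h2 : pos q < pos p') (h3 : pos p' < pos q') (hp : (glue a b).comap outer p p')
    (hq : (glue a b).comap outer q q') : False := by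
  have huniq := comp_existsUnique ha.existsUnique_mate hb.existsUnique_mate
  obtain ⟨f, f1, f2, f3, f4⟩ := exists_mate huniq
  have hpne : p' ≠ p := by rintro rfl; omega
  have hqne : q' ≠ q := by rintro rfl; omega
  have hnot : ∀ s, pos s ≠ pos q → pos s ≠ pos q' → ¬ glue a b (outer q) (outer s) := by
    intro s hs1 hs2 hs
    have e1 : q' = f q := (f4 q q' hq).resolve_left hqne
    rcases f4 q s hs with h | h
    · exact hs1 (by rw [h])
    · exact hs2 (by rw [h, e1])
  let C : GluePt n → Prop := fun v => glue a b (outer q) v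
  have hC : ∀ u v, glue a b u v → C u → C v := fun u v h h' => (glue a b).trans h' h
  let F : GluePt n → ZMod 2 := fun v => ∑ x : Fin n, if C (v.1, x) ∧ x < v.2 then 1 else 0
  have Flo : ∀ x, F (lower x) = leftParity (fun s => C (lower s)) x := by
    rintro (x | x) <;> rfl
  have Fup : ∀ x, F (upper x) = leftParity (fun s => C (upper s)) x := by
    rintro (x | x) <;> rfl
  have Fou : ∀ x, F (outer x) = leftParity (fun s => C (outer s)) x := by
    rintro (x | x) <;> rfl
  have hlo : ∀ x y, b x y → glue a b (lower x) (lower y) := fun x y h =>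
    le_sup_left (b := a.map upper) (map_mk lower h)
  have hup : ∀ x y, a x y → glue a b (upper x) (upper y) := fun x y h =>
    le_sup_right (a := b.map lower) (map_mk upper h)
  have hle : glue a b ≤ Setoid.ker (fun v => if C v then none else some (F v)) := by
    refine sup_le (map_le.2 fun x y h => ?_) (map_le.2 fun x y h => ?_)
    · change (if C (lower x) then none else some (F (lower x))) =
        if C (lower y) then none else some (F (lower y))
      by_cases hx : C (lower x)
      · rw [if_pos hx, if_pos (hC _ _ (hlo x y h) hx)]
      · rw [if_neg hx, if_neg fun hy => hx (hC _ _ (hlo y x (b.symm h)) hy), Flo, Flo]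
        congr 1
        exact leftParity_const hb _ (fun s t hst => hC _ _ (hlo s t hst)) x y h hx
    · change (if C (upper x) then none else some (F (upper x))) =
        if C (upper y) then none else some (F (upper y))
      by_cases hx : C (upper x)
      · rw [if_pos hx, if_pos (hC _ _ (hup x y h) hx)]
      · rw [if_neg hx, if_neg fun hy => hx (hC _ _ (hup y x (a.symm h)) hy), Fup, Fup]
        congr 1
        exact leftParity_const ha _ (fun s t hst => hC _ _ (hup s t hst)) x y h hx
  have hpC : ¬ C (outer p) := hnot p (by omega) (by omega)
  have hpC' : ¬ C (outer p') := hnot p' (by omega) (by omega)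
  have hF : F (outer p) = F (outer p') := by
    have := hle hp
    change (if C (outer p) then none else some (F (outer p))) =
      if C (outer p') then none else some (F (outer p')) at this
    rw [if_neg hpC, if_neg hpC'] at this
    exact Option.some.inj this
  have heven := sum_saturated huniq (fun s => C (outer s)) (fun s t _ hst => hC _ _ hst)
  rw [Fou, Fou, leftParity_eq _ heven p hpC, leftParity_eq _ heven p' hpC'] at hF
  have hCs : ∀ s, C (outer s) → pos s = pos q ∨ pos s = pos q' := by
    intro s hs
    by_contra h
    push Not at h
    exact hnot s h.1 h.2 hs
  rw [Finset.sum_eq_zero, Finset.sum_eq_single q] at hF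
  · rw [if_pos ⟨(glue a b).refl _, h2⟩] at hF
    exact absurd hF (by decide)
  · intro s _ hsq
    rw [if_neg]
    rintro ⟨hs, hlt⟩
    rcases hCs s hs with h | h
    · exact hsq (pos_injective h)
    · omega
  · intro h; exact absurd (Finset.mem_univ _) h
  · intro s _
    rw [if_neg]
    rintro ⟨hs, hlt⟩
    rcases hCs s hs with h | h <;> omega

namespace Diagram

/-- The composite of `a` on top of `b`, with the internal components removed: two boundary points
are joined if they lie in the same component of the glued diagram. -/
def comp {n : ℕ} (a b : Diagram n) : Diagram n where
  rel := (glue a.rel b.rel).comap outer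
  isCrossingless :=
    ⟨comp_existsUnique a.isCrossingless.existsUnique_mate b.isCrossingless.existsUnique_mate,
      comp_noncrossing a.isCrossingless b.isCrossingless⟩

/-- The identity diagram: the `i`-th bottom point is joined to the `i`-th top point. -/
def id (n : ℕ) : Diagram n where
  rel := Setoid.ker (Sum.elim (fun i => i) (fun i => i))
  isCrossingless := by
    refine ⟨?_, ?_⟩
    · rintro (p | p)
      · refine ⟨Sum.inr p, ⟨by simp, rfl⟩, ?_⟩
        rintro (q | q) ⟨h1, h2⟩ <;> have h3 : p = q := h2 <;> simp_all
      · refine ⟨Sum.inl p, ⟨by simp, rfl⟩, ?_⟩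
        rintro (q | q) ⟨h1, h2⟩ <;> have h3 : p = q := h2 <;> simp_all
    · rintro (p | p) (q | q) (p' | p') (q' | q') h1 h2 h3 hp hq <;>
        replace hp : p = p' := hp <;> replace hq : q = q' := hq <;> subst hp hq <;>
        simp [pos] at h1 h2 h3 <;> omega

end Diagram

theorem glue_id_left {n : ℕ} (b : Diagram n) :
    glue (Diagram.id n).rel b.rel =
      b.rel.comap (fun v => if v.1 = 0 then Sum.inl v.2 else Sum.inr v.2) := by
  have hlo : ∀ p q, b.rel p q → glue (Diagram.id n).rel b.rel (lower p) (lower q) := fun p q h =>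
    le_sup_left (b := (Diagram.id n).rel.map upper) (map_mk lower h)
  have hup : ∀ x, glue (Diagram.id n).rel b.rel (1, x) (2, x) := fun x =>
    le_sup_right (a := b.rel.map lower)
      (map_mk upper (x := Sum.inl x) (y := Sum.inr x) (r := (Diagram.id n).rel) rfl)
  apply le_antisymm
  · refine sup_le (map_le.2 ?_) (map_le.2 ?_)
    · rintro (x | x) (y | y) h <;> exact h
    · rintro (x | x) (y | y) h <;> obtain rfl : x = y := h <;> exact b.rel.refl _
  · have key : ∀ v : GluePt n, glue (Diagram.id n).rel b.rel v
        (lower (if v.1 = 0 then Sum.inl v.2 else Sum.inr v.2)) := by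
      rintro ⟨r, x⟩
      fin_cases r
      · exact (glue (Diagram.id n).rel b.rel).refl _
      · exact (glue (Diagram.id n).rel b.rel).refl _
      · exact (glue (Diagram.id n).rel b.rel).symm (hup x)
    intro u v h
    exact (glue _ _).trans (key u) ((glue _ _).trans (hlo _ _ h) ((glue _ _).symm (key v)))

theorem glue_id_right {n : ℕ} (a : Diagram n) :
    glue a.rel (Diagram.id n).rel =
      a.rel.comap (fun v => if v.1 = 2 then Sum.inr v.2 else Sum.inl v.2) := by
  have hup : ∀ p q, a.rel p q → glue a.rel (Diagram.id n).rel (upper p) (upper q) := fun p q h =>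
    le_sup_right (a := (Diagram.id n).rel.map lower) (map_mk upper h)
  have hlo : ∀ x, glue a.rel (Diagram.id n).rel (0, x) (1, x) := fun x =>
    le_sup_left (b := a.rel.map upper)
      (map_mk lower (x := Sum.inl x) (y := Sum.inr x) (r := (Diagram.id n).rel) rfl)
  apply le_antisymm
  · refine sup_le (map_le.2 ?_) (map_le.2 ?_)
    · rintro (x | x) (y | y) h <;> obtain rfl : x = y := h <;> exact a.rel.refl _
    · rintro (x | x) (y | y) h <;> exact h
  · have key : ∀ v : GluePt n, glue a.rel (Diagram.id n).rel v
        (upper (if v.1 = 2 then Sum.inr v.2 else Sum.inl v.2)) := by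
      rintro ⟨r, x⟩
      fin_cases r
      · exact hlo x
      · exact (glue a.rel (Diagram.id n).rel).refl _
      · exact (glue a.rel (Diagram.id n).rel).refl _
    intro u v h
    exact (glue _ _).trans (key u) ((glue _ _).trans (hup _ _ h) ((glue _ _).symm (key v)))

theorem internalCount_eq_zero {V P : Type} (g : Setoid V) (o : P → V)
    (h : ∀ v, ∃ p, g v (o p)) : internalCount g o = 0 := by
  have : IsEmpty {c : Quotient g // ∀ p, c ≠ Quotient.mk g (o p)} := by
    refine ⟨fun ⟨c, hc⟩ => ?_⟩
    obtain ⟨v, rfl⟩ := Quotient.exists_rep c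
    obtain ⟨p, hp⟩ := h v
    exact hc p (Quotient.sound hp)
  exact Nat.card_of_isEmpty

theorem Phi_id_left {n : ℕ} (b : Diagram n) : Phi (Diagram.id n) b = 0 := by
  apply internalCount_eq_zero
  rw [glue_id_left]
  rintro ⟨r, x⟩
  fin_cases r
  · exact ⟨Sum.inl x, b.rel.refl _⟩
  · exact ⟨Sum.inr x, b.rel.refl _⟩
  · exact ⟨Sum.inr x, b.rel.refl _⟩

theorem Phi_id_right {n : ℕ} (a : Diagram n) : Phi a (Diagram.id n) = 0 := by
  apply internalCount_eq_zero
  rw [glue_id_right]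
  rintro ⟨r, x⟩
  fin_cases r
  · exact ⟨Sum.inl x, a.rel.refl _⟩
  · exact ⟨Sum.inl x, a.rel.refl _⟩
  · exact ⟨Sum.inr x, a.rel.refl _⟩

theorem id_comp {n : ℕ} (b : Diagram n) : (Diagram.id n).comp b = b := by
  apply Diagram.ext
  change (glue (Diagram.id n).rel b.rel).comap outer = b.rel
  rw [glue_id_left]
  ext p q
  rcases p with p | p <;> rcases q with q | q <;> exact Iff.rfl

theorem comp_id {n : ℕ} (a : Diagram n) : a.comp (Diagram.id n) = a := by
  apply Diagram.ext
  change (glue a.rel (Diagram.id n).rel).comap outer = a.rel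
  rw [glue_id_right]
  ext p q
  rcases p with p | p <;> rcases q with q | q <;> exact Iff.rfl

/-- Both ways of gluing three diagrams are computed by gluing them simultaneously. -/
theorem glue_three {n : ℕ} (a b c : Diagram n) :
    (a.comp b).comp c = a.comp (b.comp c) ∧
      Phi a b + Phi (a.comp b) c = Phi b c + Phi a (b.comp c) := by
  let i1 : GluePt n → Fin 4 × Fin n := fun v => (v.1.succ, v.2)
  let i2 : GluePt n → Fin 4 × Fin n := fun v => (v.1.castSucc, v.2)
  let j1 : GluePt n → Fin 4 × Fin n := fun v => (![0, 1, 3] v.1, v.2)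
  let j2 : GluePt n → Fin 4 × Fin n := fun v => (![0, 2, 3] v.1, v.2)
  have hi1 : Function.Injective i1 := by
    rintro ⟨r, x⟩ ⟨s, y⟩ h
    have h' := Prod.ext_iff.1 h
    exact Prod.ext (Fin.succ_injective _ h'.1) h'.2
  have hi2 : Function.Injective i2 := by
    rintro ⟨r, x⟩ ⟨s, y⟩ h
    have h' := Prod.ext_iff.1 h
    exact Prod.ext (Fin.castSucc_injective _ h'.1) h'.2
  have hj1 : Function.Injective j1 := by
    rintro ⟨r, x⟩ ⟨s, y⟩ h
    have h' := Prod.ext_iff.1 h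
    exact Prod.ext ((by decide : Function.Injective (![0, 1, 3] : Fin 3 → Fin 4)) h'.1) h'.2
  have hj2 : Function.Injective j2 := by
    rintro ⟨r, x⟩ ⟨s, y⟩ h
    have h' := Prod.ext_iff.1 h
    exact Prod.ext ((by decide : Function.Injective (![0, 2, 3] : Fin 3 → Fin 4)) h'.1) h'.2
  have fe : ∀ {f g : Pt n → Fin 4 × Fin n}, (∀ x, f (Sum.inl x) = g (Sum.inl x)) →
      (∀ x, f (Sum.inr x) = g (Sum.inr x)) → f = g := by
    intro f g h1 h2
    funext p
    rcases p with p | p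
    · exact h1 p
    · exact h2 p
  have e1 : i1 ∘ outer = j1 ∘ upper := fe (fun _ => rfl) (fun _ => rfl)
  have e2 : i2 ∘ outer = j2 ∘ lower := fe (fun _ => rfl) (fun _ => rfl)
  have e3 : j1 ∘ lower = i2 ∘ lower := fe (fun _ => rfl) (fun _ => rfl)
  have e4 : j2 ∘ upper = i1 ∘ upper := fe (fun _ => rfl) (fun _ => rfl)
  have e5 : i1 ∘ lower = i2 ∘ upper := fe (fun _ => rfl) (fun _ => rfl)
  have e6 : j1 ∘ outer = j2 ∘ outer := fe (fun _ => rfl) (fun _ => rfl)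
  have m1 : ∀ u x, i1 u = j1 x → ∃ p, u = outer p ∧ x = upper p := by
    rintro ⟨r, x⟩ ⟨s, y⟩ h
    have h' := Prod.ext_iff.1 h
    obtain rfl : x = y := h'.2
    have h1 : r.succ = ![0, 1, 3] s := h'.1
    have h2 : ∀ r s : Fin 3, r.succ = (![0, 1, 3] : Fin 3 → Fin 4) s →
        (r = 0 ∧ s = 1) ∨ (r = 2 ∧ s = 2) := by decide
    rcases h2 r s h1 with ⟨rfl, rfl⟩ | ⟨rfl, rfl⟩
    · exact ⟨Sum.inl x, rfl, rfl⟩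
    · exact ⟨Sum.inr x, rfl, rfl⟩
  have m2 : ∀ u x, i2 u = j2 x → ∃ p, u = outer p ∧ x = lower p := by
    rintro ⟨r, x⟩ ⟨s, y⟩ h
    have h' := Prod.ext_iff.1 h
    obtain rfl : x = y := h'.2
    have h1 : r.castSucc = ![0, 2, 3] s := h'.1
    have h2 : ∀ r s : Fin 3, r.castSucc = (![0, 2, 3] : Fin 3 → Fin 4) s →
        (r = 0 ∧ s = 0) ∨ (r = 2 ∧ s = 1) := by decide
    rcases h2 r s h1 with ⟨rfl, rfl⟩ | ⟨rfl, rfl⟩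
    · exact ⟨Sum.inl x, rfl, rfl⟩
    · exact ⟨Sum.inr x, rfl, rfl⟩
  have c1 : ∀ w, (∃ u, i1 u = w) ∨ (∃ x, j1 x = w) := by
    rintro ⟨r, x⟩
    have : ∀ r : Fin 4, (∃ s : Fin 3, s.succ = r) ∨
        (∃ s, (![0, 1, 3] : Fin 3 → Fin 4) s = r) := by decide
    rcases this r with ⟨s, hs⟩ | ⟨s, hs⟩
    · exact Or.inl ⟨(s, x), Prod.ext hs rfl⟩
    · exact Or.inr ⟨(s, x), Prod.ext hs rfl⟩
  have c2 : ∀ w, (∃ u, i2 u = w) ∨ (∃ x, j2 x = w) := by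
    rintro ⟨r, x⟩
    have : ∀ r : Fin 4, (∃ s : Fin 3, s.castSucc = r) ∨
        (∃ s, (![0, 2, 3] : Fin 3 → Fin 4) s = r) := by decide
    rcases this r with ⟨s, hs⟩ | ⟨s, hs⟩
    · exact Or.inl ⟨(s, x), Prod.ext hs rfl⟩
    · exact Or.inr ⟨(s, x), Prod.ext hs rfl⟩
  -- the simultaneous gluing
  have T1 : (glue a.rel b.rel).map i1 ⊔ c.rel.map (j1 ∘ lower) =
      (glue b.rel c.rel).map i2 ⊔ a.rel.map (j2 ∘ upper) := by
    rw [glue, glue, map_sup, map_sup, map_map, map_map, map_map, map_map, e3, e4, e5]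
    rw [sup_assoc, sup_comm (a.rel.map _), ← sup_assoc, sup_comm (b.rel.map _)]
  have A1 := comap_two_step (glue a.rel b.rel) outer c.rel i1 j1 hi1 hj1 upper lower
    (fun p => congrFun e1 p) m1
  have A2 := comap_two_step (glue b.rel c.rel) outer a.rel i2 j2 hi2 hj2 lower upper
    (fun p => congrFun e2 p) m2
  have B1 := internalCount_two_step (glue a.rel b.rel) outer c.rel i1 j1 hi1 upper lower outer
    (fun p => congrFun e1 p) m1 c1
  have B2 := internalCount_two_step (glue b.rel c.rel) outer a.rel i2 j2 hi2 lower upper outer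
    (fun p => congrFun e2 p) m2 c2
  have G1 : glue (a.comp b).rel c.rel =
      ((glue a.rel b.rel).map i1 ⊔ c.rel.map (j1 ∘ lower)).comap j1 := by
    rw [A1, sup_comm]; rfl
  have G2 : glue a.rel (b.comp c).rel =
      ((glue b.rel c.rel).map i2 ⊔ a.rel.map (j2 ∘ upper)).comap j2 := by
    rw [A2]; rfl
  rw [← G1] at B1
  rw [← G2] at B2
  constructor
  · apply Diagram.ext
    change (glue (a.comp b).rel c.rel).comap outer = (glue a.rel (b.comp c).rel).comap outer
    rw [G1, G2, T1]
    have hcc : ∀ (j : GluePt n → Fin 4 × Fin n) (T : Setoid (Fin 4 × Fin n)),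
        (T.comap j).comap outer = T.comap (j ∘ outer (n := n)) := fun j T => by
      ext p q; exact Iff.rfl
    rw [hcc, hcc, e6]
  · change internalCount _ _ + internalCount _ _ = internalCount _ _ + internalCount _ _
    rw [← B1, ← B2, T1, e6]

/-- The `m`-cyclic Temperley--Lieb monoid on `n` strands: crossingless matchings with `n` bottom
and `n` top points, with the number of internal components counted modulo `m`. The case `m = 1`
is the Temperley--Lieb monoid. -/
@[ext]
structure CyclicTL (m n : ℕ) where
  /-- the strands -/
  skeleton : Diagram n
  /-- the number of internal components modulo `m` -/
  internal : ZMod m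

/-- `x * y` is the vertical concatenation with `x` on top of `y`. -/
noncomputable instance (m n : ℕ) : Monoid (CyclicTL m n) where
  mul x y := ⟨x.skeleton.comp y.skeleton,
    x.internal + y.internal + (Phi x.skeleton y.skeleton : ZMod m)⟩
  one := ⟨Diagram.id n, 0⟩
  mul_assoc x y z := by
    obtain ⟨h1, h2⟩ := glue_three x.skeleton y.skeleton z.skeleton
    have h3 := congrArg (Nat.cast (R := ZMod m)) h2
    push_cast at h3
    refine CyclicTL.ext h1 ?_
    change x.internal + y.internal + (Phi x.skeleton y.skeleton : ZMod m) + z.internal +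
        (Phi (x.skeleton.comp y.skeleton) z.skeleton : ZMod m) =
      x.internal + (y.internal + z.internal + (Phi y.skeleton z.skeleton : ZMod m)) +
        (Phi x.skeleton (y.skeleton.comp z.skeleton) : ZMod m)
    linear_combination h3
  one_mul x := by
    refine CyclicTL.ext (id_comp x.skeleton) ?_
    change 0 + x.internal + (Phi (Diagram.id n) x.skeleton : ZMod m) = x.internal
    rw [Phi_id_left]; simp
  mul_one x := by
    refine CyclicTL.ext (comp_id x.skeleton) ?_
    change x.internal + 0 + (Phi x.skeleton (Diagram.id n) : ZMod m) = x.internal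
    rw [Phi_id_right]; simp

/-- The bottom half of a diagram, i.e. its caps together with the bottom ends of its through
strands: the two ends of a cap are related to each other, and the bottom end of a through strand
is related only to itself. (Since strands do not cross, the upper ends of the through strands in
the bottom half are ordered from left to right like the lower ones.) -/
def Diagram.bottomHalf {n : ℕ} (d : Diagram n) : Setoid (Fin n) := d.rel.comap Sum.inl

/-- The top half of a diagram, i.e. its cups together with the top ends of its through strands. -/
def Diagram.topHalf {n : ℕ} (d : Diagram n) : Setoid (Fin n) := d.rel.comap Sum.inr

/-- The number of through strands, i.e. of strands joining a bottom point and a top point. -/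
noncomputable def Diagram.through {n : ℕ} (d : Diagram n) : ℕ :=
  {i : Fin n | ∃ j : Fin n, d.rel (Sum.inl i) (Sum.inr j)}.ncard

section Green

variable {S : Type} [Monoid S]

/-- The left cell order; left multiples are larger. -/
def LeftLE (a b : S) : Prop := ∃ c, b = c * a

/-- The right cell order. -/
def RightLE (a b : S) : Prop := ∃ c, b = a * c

/-- The two-sided cell order. -/
def TwoSidedLE (a b : S) : Prop := ∃ c d, b = c * a * d

/-- Left equivalence. -/
def LeftEquiv (a b : S) : Prop := LeftLE a b ∧ LeftLE b a

/-- Right equivalence. -/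
def RightEquiv (a b : S) : Prop := RightLE a b ∧ RightLE b a

/-- Two-sided equivalence. -/
def TwoSidedEquiv (a b : S) : Prop := TwoSidedLE a b ∧ TwoSidedLE b a

/-- Left cells are the classes of left equivalence. -/
def IsLeftCell (L : Set S) : Prop := ∃ a, L = {b | LeftEquiv a b}

/-- Right cells are the classes of right equivalence. -/
def IsRightCell (R : Set S) : Prop := ∃ a, R = {b | RightEquiv a b}

/-- `J`-cells are the classes of two-sided equivalence. -/
def IsJCell (J : Set S) : Prop := ∃ a, J = {b | TwoSidedEquiv a b}

/-- `H`-cells are the nonempty intersections of a left cell and a right cell. -/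
def IsHCell (H : Set S) : Prop :=
  H.Nonempty ∧ ∃ L R, IsLeftCell L ∧ IsRightCell R ∧ H = L ∩ R

/-- A cell is idempotent if it contains an idempotent. -/
def IsIdempotentCell (C : Set S) : Prop := ∃ e ∈ C, e * e = e

/-- The order on `J`-cells induced by the two-sided cell order. -/
def JCellLE (J K : {J : Set S // IsJCell J}) : Prop := ∀ a ∈ J.1, ∀ b ∈ K.1, TwoSidedLE a b

end Green

/-- The set of elements with exactly `k` through strands. -/
def throughClass (m n k : ℕ) : Set (CyclicTL m n) := {x | x.skeleton.through = k}

/-- The number `(n - k) / 2`, used for `k ≤ n` of the same parity as `n`. -/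
def capNumber (n k : ℕ) : ℕ := (n - k) / 2

/-- The underlying element of the Temperley--Lieb monoid, where internal components are removed. -/
def CyclicTL.toTL {m n : ℕ} (x : CyclicTL m n) : CyclicTL 1 n := ⟨x.skeleton, 0⟩

end TemperleyLieb

/-! Cut across its through strands, a diagram falls into a bottom half and a top half with the same
number k of defects, the ends of through strands. Conversely, two such halves fit together in
exactly one way: through strands cannot cross, so the r-th defect below is joined to the r-th defect
above (`isCrossingless_label`, `exists_eq_ofHalves`).

Two facts about products then govern the one-sided orders. If the halves that meet in the middle
agree, the product keeps just the outer halves (`comp_ofHalves`), so elements with a common bottom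
half are left multiples of each other. On the other hand a product retains all caps of its lower
factor and all cups of its upper factor (`bottomHalf_le_comp`, `topHalf_le_comp`), and a half
diagram which contains another one with equally many defects is equal to it (`Half.eq_of_rel_le`).
Hence a multiple that leaves the cell has lost through strands. For the two-sided order, a nested
pair of half diagrams lowers the number of through strands to any smaller value of the right parity
(`comp_ofHalves_of_le`, `exists_half_pair`).

The internal counts do not affect the orders, because they lie in a group and a multiplier can carry
any correction. They inflate each H-cell to size m, and an idempotent H-cell becomes the additive
group of `ZMod m` after a shift by the number of circles in the square of its skeleton.

Finally, the elements with k through strands correspond to triples of a bottom half, a top half and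
a residue. Half diagrams are counted by removing the rightmost point, which gives the ballot
recursion (`bijective_half_succ`) and, by Pascal's rule, the closed formula (`ballot_mul`). -/

namespace TemperleyLieb

/-! ### Half diagrams as involutions, and their defects -/

/-- A crossingless partial matching of the points `x < n` on a line, given by the involution which
exchanges the two ends of each arc, such that no fixed point lies below an arc. -/
structure IsHalf (n : ℕ) (f : ℕ → ℕ) : Prop where
  invol : ∀ x, f (f x) = x
  fix : ∀ x, n ≤ x → f x = x
  nested : ∀ x y, x < y → y < f x → x < f y ∧ f y < f x ∧ f y ≠ y

/-- The number of fixed points of `f` below `x`. -/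
def defects (f : ℕ → ℕ) (x : ℕ) : ℕ := Nat.count (fun y => f y = y) x

/-- Half diagrams on `n` points with `k` through ends. -/
abbrev Half (n k : ℕ) : Type := {f : ℕ → ℕ // IsHalf n f ∧ defects f n = k}

theorem IsHalf.lt {n : ℕ} {f : ℕ → ℕ} (h : IsHalf n f) {x : ℕ} (hx : x < n) : f x < n := by
  by_contra h1
  have h2 := h.fix _ (not_lt.1 h1)
  rw [h.invol] at h2
  omega

theorem defects_lt {f : ℕ → ℕ} {x y : ℕ} (hx : f x = x) (h : x < y) :
    defects f x < defects f y :=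
  Nat.count_strict_mono (p := fun y => f y = y) hx h

theorem defects_injective {f : ℕ → ℕ} {x y : ℕ} (hx : f x = x) (hy : f y = y)
    (h : defects f x = defects f y) : x = y :=
  Nat.count_injective (p := fun y => f y = y) hx hy h

theorem exists_defect {f : ℕ → ℕ} {n r : ℕ} (h : r < defects f n) :
    ∃ x < n, f x = x ∧ defects f x = r := by
  induction n with
  | zero => simp [defects] at h
  | succ n ih =>
    by_cases h1 : r < defects f n
    · obtain ⟨x, hx, h2⟩ := ih h1
      exact ⟨x, by omega, h2⟩
    · have h2 : defects f (n + 1) = defects f n + if f n = n then 1 else 0 := Nat.count_succ _ _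
      split_ifs at h2 with h3
      · exact ⟨n, by omega, h3, by omega⟩
      · omega

/-! ### Labels for the strands of a diagram -/

/-- A label which is the same for the two ends of an arc, and which for a fixed point is its
number, counted from the left. The labels of arcs are marked by `s`. -/
def label (f : ℕ → ℕ) (s x : ℕ) : ℕ × ℕ :=
  if f x = x then (0, defects f x) else (s, min x (f x))

theorem label_of_eq {f : ℕ → ℕ} {x : ℕ} (s : ℕ) (h : f x = x) : label f s x = (0, defects f x) :=
  if_pos h

theorem label_of_ne {f : ℕ → ℕ} {x : ℕ} (s : ℕ) (h : f x ≠ x) : label f s x = (s, min x (f x)) :=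
  if_neg h

/-- Defects are told apart by their number and arcs by their left end. A positive mark keeps arcs
apart from defects, whose mark is 0. -/
theorem label_eq_iff {f : ℕ → ℕ} (hf : ∀ x, f (f x) = x) {s : ℕ} (hs : 0 < s) (x y : ℕ) :
    label f s x = label f s y ↔ y = x ∨ y = f x := by
  by_cases hx : f x = x <;> by_cases hy : f y = y
  · rw [label_of_eq s hx, label_of_eq s hy, hx, or_self]
    constructor
    · intro h
      exact (defects_injective hx hy (Prod.ext_iff.1 h).2).symm
    · rintro rfl; rfl
  · rw [label_of_eq s hx, label_of_ne s hy, hx, or_self]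
    constructor
    · intro h
      have := (Prod.ext_iff.1 h).1
      simp at this
      omega
    · rintro rfl; exact (hy hx).elim
  · rw [label_of_ne s hx, label_of_eq s hy]
    constructor
    · intro h
      have := (Prod.ext_iff.1 h).1
      simp at this
      omega
    · rintro (rfl | rfl)
      · exact (hx hy).elim
      · rw [hf] at hy; exact (hx hy.symm).elim
  · rw [label_of_ne s hx, label_of_ne s hy]
    constructor
    · intro h
      have h1 : min x (f x) = min y (f y) := (Prod.ext_iff.1 h).2
      have h2 := hf x
      have h3 := hf y
      rcases min_choice x (f x) with h4 | h4 <;> rcases min_choice y (f y) with h5 | h5 <;>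
        rw [h4, h5] at h1
      · exact Or.inl h1.symm
      · rw [h1, h3]; exact Or.inr rfl
      · exact Or.inr h1.symm
      · rw [h1] at h2; exact Or.inl (h3.symm.trans h2)
    · rintro (rfl | rfl)
      · rfl
      · rw [hf, min_comm]

/-- Rows with different positive marks share no arc labels, so only defects can connect them. -/
theorem label_eq_of_ne {f g : ℕ → ℕ} {s t : ℕ} (hs : 0 < s) (ht : 0 < t) (hst : s ≠ t) {x y : ℕ}
    (h : label f s x = label g t y) : f x = x ∧ g y = y ∧ defects f x = defects g y := by
  by_cases hx : f x = x <;> by_cases hy : g y = y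
  · rw [label_of_eq s hx, label_of_eq t hy] at h
    exact ⟨hx, hy, (Prod.ext_iff.1 h).2⟩
  · rw [label_of_eq s hx, label_of_ne t hy] at h
    have := (Prod.ext_iff.1 h).1
    simp at this
    omega
  · rw [label_of_ne s hx, label_of_eq t hy] at h
    have := (Prod.ext_iff.1 h).1
    simp at this
    omega
  · rw [label_of_ne s hx, label_of_ne t hy] at h
    exact (hst (Prod.ext_iff.1 h).1).elim

theorem label_congr {f g : ℕ → ℕ} {x y : ℕ} (hx : f x = x) (hy : g y = y)
    (h : defects f x = defects g y) (s t : ℕ) : label f s x = label g t y := by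
  rw [label_of_eq s hx, label_of_eq t hy, h]

/-- The labels of the boundary points of the diagram with given bottom and top halves. -/
def diagramLabel {n : ℕ} (f g : ℕ → ℕ) : Pt n → ℕ × ℕ :=
  Sum.elim (fun i => label f 1 i) (fun i => label g 2 i)

theorem exists_mate_label {n : ℕ} {f g : ℕ → ℕ} (hf : IsHalf n f)
    (hc : defects f n = defects g n) {s t : ℕ} (hs : 0 < s) {x : ℕ} (hx : x < n) :
    (∃ y < n, y ≠ x ∧ label f s x = label f s y) ∨ ∃ y < n, label f s x = label g t y := by
  by_cases h : f x = x
  · obtain ⟨y, hy, h1, h2⟩ := exists_defect (hc ▸ defects_lt h hx)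
    exact Or.inr ⟨y, hy, label_congr h h1 h2.symm s t⟩
  · exact Or.inl ⟨f x, hf.lt hx, h, (label_eq_iff hf.invol hs x _).2 (Or.inr rfl)⟩

theorem mate_label_unique {f : ℕ → ℕ} (hf : ∀ x, f (f x) = x) {s : ℕ} (hs : 0 < s) {x y z : ℕ}
    (hy : y ≠ x) (hz : z ≠ x) (hxy : label f s x = label f s y) (hxz : label f s x = label f s z) :
    y = z := by
  rw [label_eq_iff hf hs] at hxy hxz
  rw [hxy.resolve_left hy, hxz.resolve_left hz]

/-- Arcs of one half do not cross by nestedness, no through strand meets an arc since no defect lies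
below an arc, and through strands do not cross since defects are numbered from the left on both
sides. The equal number of defects provides every defect with a partner. -/
theorem isCrossingless_label {n : ℕ} {f g : ℕ → ℕ} (hf : IsHalf n f) (hg : IsHalf n g)
    (hc : defects f n = defects g n) :
    IsCrossinglessMatching (Setoid.ker (diagramLabel (n := n) f g)) := by
  have e1 : ∀ x y, label f 1 x = label f 1 y ↔ y = x ∨ y = f x :=
    label_eq_iff hf.invol one_pos
  have e2 : ∀ x y, label g 2 x = label g 2 y ↔ y = x ∨ y = g x :=
    label_eq_iff hg.invol two_pos
  have e12 : ∀ {x y}, label f 1 x = label g 2 y → f x = x ∧ g y = y ∧ defects f x = defects g y :=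
    fun h => label_eq_of_ne one_pos two_pos (by decide) h
  have e21 : ∀ {x y}, label g 2 x = label f 1 y → g x = x ∧ f y = y ∧ defects g x = defects f y :=
    fun h => label_eq_of_ne two_pos one_pos (by decide) h
  constructor
  · have hex : ∀ p : Pt n, ∃ q, q ≠ p ∧ diagramLabel f g p = diagramLabel f g q := by
      rintro (⟨x, hx⟩ | ⟨x, hx⟩)
      · rcases exists_mate_label (g := g) (t := 2) hf hc one_pos hx with
          ⟨y, hy, h1, h2⟩ | ⟨y, hy, h1⟩
        · exact ⟨Sum.inl ⟨y, hy⟩, by simpa using h1, h2⟩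
        · exact ⟨Sum.inr ⟨y, hy⟩, by simp, h1⟩
      · rcases exists_mate_label (g := f) (t := 1) hg hc.symm two_pos hx with
          ⟨y, hy, h1, h2⟩ | ⟨y, hy, h1⟩
        · exact ⟨Sum.inr ⟨y, hy⟩, by simpa using h1, h2⟩
        · exact ⟨Sum.inl ⟨y, hy⟩, by simp, h1⟩
    intro p
    obtain ⟨q, hq, hpq⟩ := hex p
    refine ⟨q, ⟨hq, hpq⟩, ?_⟩
    rintro r ⟨hr, hpr⟩
    change diagramLabel f g p = diagramLabel f g r at hpr
    -- A point with a mate in its own half is not fixed, one with a mate in the other half is; this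
    -- excludes the mixed cases.
    rcases p with ⟨x, hx⟩ | ⟨x, hx⟩ <;> rcases q with ⟨y, hy⟩ | ⟨y, hy⟩ <;>
      rcases r with ⟨z, hz⟩ | ⟨z, hz⟩ <;>
      simp only [diagramLabel, Sum.elim_inl, Sum.elim_inr, ne_eq, Sum.inl.injEq, Sum.inr.injEq,
        Fin.mk.injEq, reduceCtorEq, not_false_eq_true] at hq hr hpq hpr ⊢
    · exact mate_label_unique hf.invol one_pos hr hq hpr hpq
    · have := e12 hpr
      rw [e1] at hpq
      omega
    · have := e12 hpq
      rw [e1] at hpr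
      omega
    · obtain ⟨-, h1, h2⟩ := e12 hpq
      obtain ⟨-, h3, h4⟩ := e12 hpr
      exact defects_injective h3 h1 (h4.symm.trans h2)
    · obtain ⟨-, h1, h2⟩ := e21 hpq
      obtain ⟨-, h3, h4⟩ := e21 hpr
      exact defects_injective h3 h1 (h4.symm.trans h2)
    · have := e21 hpq
      rw [e2] at hpr
      omega
    · have := e21 hpr
      rw [e2] at hpq
      omega
    · exact mate_label_unique hg.invol two_pos hr hq hpr hpq
  · intro p q p' q' h1 h2 h3 hp hq
    change diagramLabel f g p = diagramLabel f g p' at hp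
    change diagramLabel f g q = diagramLabel f g q' at hq
    -- All bottom points precede all top points, so only five of the sixteen cases survive `omega`:
    -- four, three, two, one or no bottom points, and these come first. Along the top, positions
    -- decrease from left to right.
    rcases p with ⟨x, hx⟩ | ⟨x, hx⟩ <;> rcases q with ⟨y, hy⟩ | ⟨y, hy⟩ <;>
      rcases p' with ⟨x', hx'⟩ | ⟨x', hx'⟩ <;> rcases q' with ⟨y', hy'⟩ | ⟨y', hy'⟩ <;>
      simp only [pos, diagramLabel, Sum.elim_inl, Sum.elim_inr, Fin.val_rev] at h1 h2 h3 hp hq <;>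
      try omega
    · have h4 := hf.nested x y
      rw [e1] at hp hq
      rcases hp with rfl | rfl <;> rcases hq with rfl | rfl <;> omega
    · have h4 := hf.nested x y
      have := e12 hq
      rw [e1] at hp
      rcases hp with rfl | rfl <;> omega
    · obtain ⟨h4, h5, h6⟩ := e12 hp
      obtain ⟨h7, h8, h9⟩ := e12 hq
      have := defects_lt h4 h1
      have := defects_lt h8 (show y' < x' by omega)
      omega
    · have h4 := hg.nested y' x'
      have := e12 hp
      have h5 := hg.invol y
      rw [e2] at hq
      rcases hq with rfl | rfl
      · omega
      · rw [h5] at h4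
        omega
    · have h4 := hg.nested y' x'
      have h5 := hg.invol y
      have h6 := hg.invol x
      rw [e2] at hp hq
      rcases hp with rfl | rfl <;> rcases hq with rfl | rfl <;> try omega

/-! ### Diagrams built from two halves, and their products -/

/-- The diagram with bottom half `b` and top half `t`. -/
def Diagram.ofHalves {n k : ℕ} (b t : Half n k) : Diagram n where
  rel := Setoid.ker (diagramLabel b.1 t.1)
  isCrossingless := isCrossingless_label b.2.1 t.2.1 (b.2.2.trans t.2.2.symm)

/-- The relation "lies on the same arc" of a half diagram. -/
def Half.rel {n k : ℕ} (b : Half n k) : Setoid (Fin n) := Setoid.ker fun i => label b.1 1 i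

theorem Half.rel_iff {n k : ℕ} (b : Half n k) (i j : Fin n) :
    b.rel i j ↔ (j : ℕ) = i ∨ (j : ℕ) = b.1 i :=
  label_eq_iff b.2.1.invol one_pos _ _

theorem bottomHalf_ofHalves {n k : ℕ} (b t : Half n k) :
    (Diagram.ofHalves b t).bottomHalf = b.rel := rfl

theorem topHalf_ofHalves {n k : ℕ} (b t : Half n k) :
    (Diagram.ofHalves b t).topHalf = t.rel := by
  ext i j
  rw [t.rel_iff]
  exact label_eq_iff t.2.1.invol two_pos _ _

theorem defects_eq_card (f : ℕ → ℕ) (n : ℕ) :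
    defects f n = {x ∈ Finset.range n | f x = x}.card :=
  Nat.count_eq_card_filter_range _ _

/-- The through strands start exactly at the defects of `b`, since each of these finds the defect of
`t` with the same number. -/
theorem through_ofHalves {n k : ℕ} (b t : Half n k) : (Diagram.ofHalves b t).through = k := by
  have h : {i : Fin n | ∃ j : Fin n, (Diagram.ofHalves b t).rel (Sum.inl i) (Sum.inr j)} =
      {i : Fin n | b.1 i = i} := by
    ext i
    constructor
    · rintro ⟨j, hj⟩
      exact (label_eq_of_ne one_pos two_pos (by decide) hj).1
    · intro hi
      have h1 := defects_lt hi i.2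
      rw [b.2.2.trans t.2.2.symm] at h1
      obtain ⟨y, hy, h2, h3⟩ := exists_defect h1
      exact ⟨⟨y, hy⟩, label_congr hi h2 h3.symm 1 2⟩
  refine Eq.trans ?_ b.2.2
  rw [Diagram.through, h, defects_eq_card, ← Set.ncard_coe_finset,
    ← Set.ncard_image_of_injective _ Fin.val_injective]
  congr 1
  ext x
  simp only [Set.mem_image, Set.mem_ofPred_eq, Finset.coe_filter, Finset.mem_range]
  constructor
  · rintro ⟨i, hi, rfl⟩; exact ⟨i.2, hi⟩
  · rintro ⟨hx, h⟩; exact ⟨⟨x, hx⟩, h, rfl⟩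

/-- A partition into pairs cannot strictly refine another one, so a single inclusion is enough to
identify a diagram. -/
theorem Diagram.eq_of_le {n : ℕ} {a b : Diagram n} (h : a.rel ≤ b.rel) : a = b := by
  apply Diagram.ext
  refine le_antisymm h fun p q hpq => ?_
  by_cases hqp : q = p
  · rw [hqp]
  · obtain ⟨r, ⟨h1, h2⟩, -⟩ := a.isCrossingless.existsUnique_mate p
    rw [(b.isCrossingless.existsUnique_mate p).unique ⟨hqp, hpq⟩ ⟨h1, h h2⟩]
    exact h2

/-- Computes a product without following paths. A colouring `F` that is constant on all strands is
constant on components; if its colours on the outer points separate the strands of `d`, the product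
refines `d` and hence equals it. -/
theorem comp_eq_of_glue_le {n : ℕ} {a b d : Diagram n} {X : Type} (F : GluePt n → X)
    (hb : ∀ p q, b.rel p q → F (lower p) = F (lower q))
    (ha : ∀ p q, a.rel p q → F (upper p) = F (upper q))
    (hd : ∀ p q, F (outer p) = F (outer q) → d.rel p q) : a.comp b = d := by
  refine Diagram.eq_of_le fun p q hpq => hd p q ?_
  have : glue a.rel b.rel ≤ Setoid.ker F :=
    sup_le (map_le.2 fun p q h => hb p q h) (map_le.2 fun p q h => ha p q h)
  exact this hpq

theorem label_eq_label_iff {f : ℕ → ℕ} (hf : ∀ x, f (f x) = x) {s t : ℕ} (hs : 0 < s)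
    (ht : 0 < t) {x y : ℕ} : label f s x = label f s y ↔ label f t x = label f t y := by
  rw [label_eq_iff hf hs, label_eq_iff hf ht]

/-- In the middle row each arc of `t` meets its mirror image and closes to a circle, while the r-th
defect passes straight on to the r-th defect of `u`. -/
theorem comp_ofHalves {n k : ℕ} (b t u : Half n k) :
    (Diagram.ofHalves t u).comp (Diagram.ofHalves b t) = Diagram.ofHalves b u := by
  refine comp_eq_of_glue_le
    -- Each row has its own mark, so the labels of the upper diagram have their marks raised by one.
    (fun v => if v.1 = 0 then label b.1 1 v.2 else if v.1 = 1 then label t.1 2 v.2 else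
      label u.1 3 v.2) ?_ ?_ ?_
  · rintro (x | x) (y | y) h <;> exact h
  · have key : ∀ x y : Fin n, label t.1 1 x = label u.1 2 y → label t.1 2 x = label u.1 3 y := by
      intro x y h
      obtain ⟨h1, h2, h3⟩ := label_eq_of_ne one_pos two_pos (by decide) h
      exact label_congr h1 h2 h3 _ _
    rintro (x | x) (y | y) h
    · exact (label_eq_label_iff t.2.1.invol one_pos two_pos).1 h
    · exact key x y h
    · exact (key y x h.symm).symm
    · exact (label_eq_label_iff u.2.1.invol two_pos three_pos).1 h
  · have key : ∀ x y : Fin n, label b.1 1 x = label u.1 3 y → label b.1 1 x = label u.1 2 y := by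
      intro x y h
      obtain ⟨h1, h2, h3⟩ := label_eq_of_ne one_pos three_pos (by decide) h
      exact label_congr h1 h2 h3 _ _
    rintro (x | x) (y | y) h
    · exact h
    · exact key x y h
    · exact (key y x h.symm).symm
    · exact (label_eq_label_iff u.2.1.invol two_pos three_pos).2 h

/-- The through strands of the lower diagram are vertical and its arcs are already arcs of `c`, so
colouring both lower rows by the labels of `c` is consistent. -/
theorem comp_ofHalves_of_le {n k l : ℕ} (b : Half n k) (c : Half n l) (h : b.rel ≤ c.rel) :
    (Diagram.ofHalves c c).comp (Diagram.ofHalves b b) = Diagram.ofHalves c c := by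
  refine comp_eq_of_glue_le (fun v => if v.1 = 2 then label c.1 2 v.2 else label c.1 1 v.2) ?_ ?_ ?_
  · have key : ∀ x y : Fin n, label b.1 1 x = label b.1 2 y → label c.1 1 x = label c.1 1 y := by
      intro x y h
      obtain ⟨h1, h2, h3⟩ := label_eq_of_ne one_pos two_pos (by decide) h
      rw [defects_injective h1 h2 h3]
    rintro (x | x) (y | y) hxy
    · exact h hxy
    · exact key x y hxy
    · exact (key y x hxy.symm).symm
    · exact h ((label_eq_label_iff b.2.1.invol two_pos one_pos).1 hxy)
  · rintro (x | x) (y | y) h <;> exact h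
  · rintro (x | x) (y | y) h <;> exact h

/-! ### Splitting a diagram into its halves -/

/-- The properties of the map which takes a boundary point to the other end of its strand. -/
structure IsMate {n : ℕ} (M : Pt n → Pt n) : Prop where
  invol : ∀ p, M (M p) = p
  ne : ∀ p, M p ≠ p
  nested : ∀ p q, pos p < pos q → pos q < pos (M p) →
    pos p < pos (M q) ∧ pos (M q) < pos (M p)

theorem exists_isMate {n : ℕ} (d : Diagram n) :
    ∃ M : Pt n → Pt n, IsMate M ∧ ∀ p q, d.rel p q → q = p ∨ q = M p := by
  obtain ⟨M, h1, h2, h3, h4⟩ := exists_mate d.isCrossingless.existsUnique_mate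
  refine ⟨M, ⟨h1, h2, fun p q hpq hq => ?_⟩, h4⟩
  have h5 : pos (M q) ≠ pos p := fun h => by
    rw [← pos_injective h, h1] at hq
    exact lt_irrefl _ hq
  have h6 : pos (M q) ≠ pos (M p) := fun h => by
    have := pos_injective h
    have := congrArg pos (((h1 q).symm.trans (congrArg M this)).trans (h1 p))
    omega
  by_contra h
  rcases lt_or_ge (pos (M q)) (pos p) with h7 | h7
  · exact d.isCrossingless.noncrossing (M q) p q (M p) h7 hpq hq (d.rel.symm (h3 q)) (h3 p)
  · exact d.isCrossingless.noncrossing p q (M p) (M q) hpq hq (by omega) (h3 p) (h3 q)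

/-- Turning a diagram upside down reverses the order of the boundary points, hence preserves
nestedness. Facts about top halves thus follow from those about bottom halves. -/
theorem pos_swap {n : ℕ} (p : Pt n) : pos p.swap + pos p + 1 = 2 * n := by
  rcases p with i | i <;> simp [pos] <;> omega

/-- The mates in the diagram which is flipped upside down. -/
def flipMate {n : ℕ} (M : Pt n → Pt n) (p : Pt n) : Pt n := (M p.swap).swap

theorem IsMate.flip {n : ℕ} {M : Pt n → Pt n} (h : IsMate M) : IsMate (flipMate M) := by
  refine ⟨fun p => by simp [flipMate, h.invol], fun p hp => h.ne p.swap ?_,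
    fun p q hpq hq => ?_⟩
  · simpa [flipMate] using congrArg Sum.swap hp
  · have h1 := h.nested (M p.swap) q.swap
    rw [h.invol] at h1
    have h2 := pos_swap p
    have h3 := pos_swap q
    have h4 := pos_swap (M p.swap)
    have h5 := pos_swap (M q.swap)
    unfold flipMate at hq ⊢
    omega

/-- The involution given by the caps of a diagram. -/
def capFun {n : ℕ} (M : Pt n → Pt n) (x : ℕ) : ℕ :=
  if h : x < n then Sum.elim Fin.val (fun _ => x) (M (Sum.inl ⟨x, h⟩)) else x

theorem capFun_of_inl {n : ℕ} {M : Pt n → Pt n} {i j : Fin n} (h : M (Sum.inl i) = Sum.inl j) :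
    capFun M i = j := by
  simp [capFun, h]

theorem capFun_of_inr {n : ℕ} {M : Pt n → Pt n} {i j : Fin n} (h : M (Sum.inl i) = Sum.inr j) :
    capFun M i = i := by
  simp [capFun, h]

theorem capFun_of_le {n : ℕ} {M : Pt n → Pt n} {x : ℕ} (h : n ≤ x) : capFun M x = x :=
  dif_neg (not_lt.2 h)

theorem exists_inl_of_capFun_ne {n : ℕ} {M : Pt n → Pt n} {x : ℕ} (h : capFun M x ≠ x) :
    ∃ i j : Fin n, (i : ℕ) = x ∧ (j : ℕ) = capFun M x ∧ M (Sum.inl i) = Sum.inl j := by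
  by_cases hx : x < n
  · rcases hM : M (Sum.inl ⟨x, hx⟩) with j | j
    · exact ⟨⟨x, hx⟩, j, rfl, (capFun_of_inl hM).symm, hM⟩
    · exact (h (capFun_of_inr hM)).elim
  · exact (h (capFun_of_le (not_lt.1 hx))).elim

theorem IsMate.exists_inr_of_capFun_eq {n : ℕ} {M : Pt n → Pt n} (hM : IsMate M) {i : Fin n}
    (h : capFun M i = i) : ∃ j : Fin n, M (Sum.inl i) = Sum.inr j := by
  rcases h1 : M (Sum.inl i) with j | j
  · rw [capFun_of_inl h1] at h
    rw [Fin.ext h] at h1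
    exact (hM.ne _ h1).elim
  · exact ⟨j, rfl⟩

theorem IsMate.isHalf {n : ℕ} {M : Pt n → Pt n} (hM : IsMate M) : IsHalf n (capFun M) := by
  refine ⟨fun x => ?_, fun x hx => capFun_of_le hx, fun x y hxy hy => ?_⟩
  · by_cases h : capFun M x = x
    · rw [h, h]
    · obtain ⟨i, j, rfl, h2, h3⟩ := exists_inl_of_capFun_ne h
      rw [← h2]
      exact capFun_of_inl (by rw [← h3, hM.invol])
  · obtain ⟨i, j, rfl, h2, h3⟩ := exists_inl_of_capFun_ne (M := M) (x := x) (by omega)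
    have hyn : y < n := by omega
    have h4 := hM.nested (Sum.inl i) (Sum.inl ⟨y, hyn⟩)
    rw [h3] at h4
    rcases h5 : M (Sum.inl ⟨y, hyn⟩) with l | l
    · have h6 : capFun M y = l := capFun_of_inl h5
      have h7 := hM.ne (Sum.inl ⟨y, hyn⟩)
      rw [h5] at h4 h7
      have h8 : (l : ℕ) ≠ y := fun h => h7 (congrArg _ (Fin.ext h))
      simp only [pos, Sum.elim_inl] at h4
      omega
    -- A through strand from below a cap would have its top end at a position before the right end
    -- of the cap, which is a bottom point.
    · rw [h5] at h4
      simp only [pos, Sum.elim_inl, Sum.elim_inr] at h4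
      omega

theorem flipMate_inl {n : ℕ} {M : Pt n → Pt n} (i : Fin n) :
    flipMate M (Sum.inl i) = (M (Sum.inr i)).swap := rfl

theorem IsMate.capFun_flip_of_inr {n : ℕ} {M : Pt n → Pt n} (hM : IsMate M) {i j : Fin n}
    (h : M (Sum.inl i) = Sum.inr j) : capFun (flipMate M) j = j := by
  apply capFun_of_inr (j := i)
  rw [flipMate_inl, ← h, hM.invol]
  rfl

theorem defects_le_of_injOn {f g : ℕ → ℕ} {x y : ℕ} (φ : ℕ → ℕ)
    (h : ∀ z < x, f z = z → φ z < y ∧ g (φ z) = φ z)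
    (hi : ∀ z < x, f z = z → ∀ w < x, f w = w → φ z = φ w → z = w) :
    defects f x ≤ defects g y := by
  rw [defects_eq_card, defects_eq_card]
  refine Finset.card_le_card_of_injOn φ (fun z hz => ?_) (fun z hz w hw => ?_)
  · simp only [Finset.coe_filter, Finset.mem_range, Set.mem_ofPred_eq] at hz ⊢
    exact h z hz.1 hz.2
  · simp only [Finset.coe_filter, Finset.mem_range, Set.mem_ofPred_eq] at hz hw
    exact hi z hz.1 hz.2 w hw.1 hw.2

/-- The top end of the through strand which starts at a given bottom point. -/
def topEnd {n : ℕ} (M : Pt n → Pt n) (x : ℕ) : ℕ :=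
  if h : x < n then Sum.elim (fun _ => x) Fin.val (M (Sum.inl ⟨x, h⟩)) else x

theorem topEnd_of_inr {n : ℕ} {M : Pt n → Pt n} {i j : Fin n} (h : M (Sum.inl i) = Sum.inr j) :
    topEnd M i = j := by
  simp [topEnd, h]

/-- Following through strands upwards is injective. The bounds `x` and `y` allow the use both for
whole rows and for the points to the left of a given through strand. -/
theorem IsMate.defects_le {n : ℕ} {M : Pt n → Pt n} (hM : IsMate M) {x y : ℕ} (hx : x ≤ n)
    (h : ∀ i j : Fin n, M (Sum.inl i) = Sum.inr j → (i : ℕ) < x → (j : ℕ) < y) :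
    defects (capFun M) x ≤ defects (capFun (flipMate M)) y := by
  refine defects_le_of_injOn (topEnd M) (fun z hz hfz => ?_) (fun z hz hfz w hw hfw hzw => ?_)
  · obtain ⟨j, hj⟩ := hM.exists_inr_of_capFun_eq (i := ⟨z, by omega⟩) hfz
    have h1 := topEnd_of_inr hj
    simp only at h1
    rw [h1]
    exact ⟨h _ _ hj hz, hM.capFun_flip_of_inr hj⟩
  · obtain ⟨j, hj⟩ := hM.exists_inr_of_capFun_eq (i := ⟨z, by omega⟩) hfz
    obtain ⟨l, hl⟩ := hM.exists_inr_of_capFun_eq (i := ⟨w, by omega⟩) hfw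
    have h1 := topEnd_of_inr hj
    have h2 := topEnd_of_inr hl
    simp only at h1 h2
    rw [h1, h2] at hzw
    rw [← Fin.ext hzw, ← hj] at hl
    have h3 := congrArg M hl
    rw [hM.invol, hM.invol] at h3
    simpa using h3.symm

theorem flipMate_flipMate {n : ℕ} (M : Pt n → Pt n) : flipMate (flipMate M) = M := by
  funext p
  simp [flipMate]

theorem IsMate.through_lt {n : ℕ} {M : Pt n → Pt n} (hM : IsMate M) {i j i' j' : Fin n}
    (h : M (Sum.inl i) = Sum.inr j) (h' : M (Sum.inl i') = Sum.inr j') (hlt : (i' : ℕ) < i) :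
    (j' : ℕ) < j := by
  have h1 := hM.nested (Sum.inl i') (Sum.inl i) hlt
  rw [h, h'] at h1
  simp only [pos, Sum.elim_inl, Sum.elim_inr, Fin.val_rev] at h1
  omega

theorem IsMate.defects_le_of_through {n : ℕ} {M : Pt n → Pt n} (hM : IsMate M) {i j : Fin n}
    (h : M (Sum.inl i) = Sum.inr j) :
    defects (capFun M) i ≤ defects (capFun (flipMate M)) j :=
  hM.defects_le i.2.le fun _ _ h' hlt => hM.through_lt h h' hlt

/-- Through strands that start to the left of this one also end to its left, as they do not cross
it. The flipped diagram gives the reverse inequality. -/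
theorem IsMate.defects_eq_of_through {n : ℕ} {M : Pt n → Pt n} (hM : IsMate M) {i j : Fin n}
    (h : M (Sum.inl i) = Sum.inr j) :
    defects (capFun M) i = defects (capFun (flipMate M)) j := by
  refine le_antisymm (hM.defects_le_of_through h) ?_
  have := hM.flip.defects_le_of_through (i := j) (j := i) (by
    rw [flipMate_inl, ← h, hM.invol]
    rfl)
  rwa [flipMate_flipMate] at this

theorem IsMate.defects_eq {n : ℕ} {M : Pt n → Pt n} (hM : IsMate M) :
    defects (capFun M) n = defects (capFun (flipMate M)) n := by
  refine le_antisymm (hM.defects_le le_rfl fun _ j _ _ => j.2) ?_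
  have := hM.flip.defects_le le_rfl fun _ j _ _ => j.2
  rwa [flipMate_flipMate] at this

theorem IsMate.label_inl {n : ℕ} {M : Pt n → Pt n} (hM : IsMate M) {i j : Fin n} {s : ℕ}
    (hs : 0 < s) (h : M (Sum.inl i) = Sum.inl j) :
    label (capFun M) s i = label (capFun M) s j :=
  (label_eq_iff hM.isHalf.invol hs _ _).2 (Or.inr (capFun_of_inl h).symm)

theorem IsMate.diagramLabel_eq {n : ℕ} {M : Pt n → Pt n} (hM : IsMate M) (p : Pt n) :
    diagramLabel (n := n) (capFun M) (capFun (flipMate M)) p =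
      diagramLabel (capFun M) (capFun (flipMate M)) (M p) := by
  have key : ∀ i j : Fin n, M (Sum.inl i) = Sum.inr j →
      label (capFun M) 1 i = label (capFun (flipMate M)) 2 j := fun i j h =>
    label_congr (capFun_of_inr h) (hM.capFun_flip_of_inr h) (hM.defects_eq_of_through h) 1 2
  rcases p with i | i <;> rcases h : M _ with j | j
  · exact hM.label_inl one_pos h
  · exact key i j h
  · exact (key j i (by rw [← h, hM.invol])).symm
  · exact hM.flip.label_inl two_pos (by rw [flipMate_inl, h]; rfl)

/-- Two ends of a strand receive the same label from the two halves, so the diagram refines the one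
rebuilt from them and `Diagram.eq_of_le` applies. -/
theorem exists_eq_ofHalves {n : ℕ} (d : Diagram n) :
    ∃ k, ∃ b t : Half n k, d = Diagram.ofHalves b t := by
  obtain ⟨M, hM, hd⟩ := exists_isMate d
  refine ⟨_, ⟨capFun M, hM.isHalf, rfl⟩, ⟨capFun (flipMate M), hM.flip.isHalf, hM.defects_eq.symm⟩,
    Diagram.eq_of_le fun p q hpq => ?_⟩
  rcases hd p q hpq with rfl | rfl
  · rfl
  · exact hM.diagramLabel_eq p

/-! ### Counting half diagrams -/

theorem defects_succ (f : ℕ → ℕ) (n : ℕ) :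
    defects f (n + 1) = defects f n + if f n = n then 1 else 0 :=
  Nat.count_succ _ _

theorem defects_le (f : ℕ → ℕ) (n : ℕ) : defects f n ≤ n := Nat.count_le _

/-- The number of half diagrams on `n` points with `k` through ends. -/
def ballot : ℕ → ℕ → ℕ
  | 0, 0 => 1
  | 0, _ + 1 => 0
  | n + 1, 0 => ballot n 1
  | n + 1, k + 1 => ballot n k + ballot n (k + 2)

theorem exists_of_ballot_ne_zero {n k : ℕ} (h : ballot n k ≠ 0) : ∃ c, n = k + 2 * c := by
  induction n generalizing k with
  | zero =>
    cases k with
    | zero => exact ⟨0, rfl⟩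
    | succ k => simp [ballot] at h
  | succ n ih =>
    cases k with
    | zero =>
      obtain ⟨c, hc⟩ := ih (k := 1) h
      exact ⟨c + 1, by omega⟩
    | succ k =>
      by_cases h1 : ballot n k = 0
      · have h2 : ballot n (k + 2) ≠ 0 := by
          intro h2
          exact h (by rw [ballot, h1, h2])
        obtain ⟨c, hc⟩ := ih h2
        exact ⟨c + 1, by omega⟩
      · obtain ⟨c, hc⟩ := ih h1
        exact ⟨c, by omega⟩

/-- The closed formula with its denominator n - c + 1 = k + c + 1 cleared, so that the induction
stays in the natural numbers. -/
theorem ballot_mul {n k c : ℕ} (h : n = k + 2 * c) :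
    ballot n k * (k + c + 1) = (k + 1) * n.choose c := by
  induction n generalizing k c with
  | zero =>
    obtain rfl : k = 0 := by omega
    obtain rfl : c = 0 := by omega
    rfl
  | succ n ih =>
    cases k with
    | zero =>
      obtain ⟨c, rfl⟩ : ∃ d, c = d + 1 := ⟨c - 1, by omega⟩
      have h1 := ih (k := 1) (c := c) (by omega)
      -- Here n = 2c + 1, and the two middle binomial coefficients agree.
      have h2 : n.choose (c + 1) = n.choose c := Nat.choose_symm_of_eq_add (by omega)
      rw [Nat.choose_succ_succ, h2, ballot]
      linarith
    | succ k =>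
      have h1 := ih (k := k) (c := c) (by omega)
      cases c with
      | zero =>
        have h2 : ballot n (k + 2) = 0 := by
          by_contra h2
          obtain ⟨c, hc⟩ := exists_of_ballot_ne_zero h2
          omega
        rw [ballot, h2]
        simp only [Nat.choose_zero_right] at h1 ⊢
        have h3 : ballot n k = 1 := by
          apply Nat.eq_of_mul_eq_mul_right (Nat.succ_pos k)
          simpa using h1
        rw [h3]
        ring
      | succ c =>
        have h2 := ih (k := k + 2) (c := c) (by omega)
        have h3 := Nat.choose_succ_right_eq n c
        rw [show n - c = k + c + 2 by omega] at h3
        rw [ballot, Nat.choose_succ_succ]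
        -- The goal carries the factor k + c + 3 of `h2`; the extra factor k + c + 2 is that of
        -- `h1`. What remains is the relation `h3` between neighbouring binomial coefficients.
        apply Nat.eq_of_mul_eq_mul_right (show 0 < k + c + 2 by omega)
        zify at h1 h2 h3 ⊢
        linear_combination (k + c + 3 : ℤ) * h1 + (k + c + 2 : ℤ) * h2 - h3

theorem IsHalf.succ {n : ℕ} {f : ℕ → ℕ} (h : IsHalf n f) : IsHalf (n + 1) f :=
  ⟨h.invol, fun x hx => h.fix x (by omega), h.nested⟩

/-- Adding a through end on the right. -/
def Half.addThrough {n k : ℕ} (b : Half n k) : Half (n + 1) (k + 1) :=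
  ⟨b.1, b.2.1.succ, by rw [defects_succ, if_pos (b.2.1.fix n le_rfl), b.2.2]⟩

/-- The function `f` changed by exchanging the fixed points `j` and `n`. -/
def joinPoints (f : ℕ → ℕ) (j n : ℕ) : ℕ → ℕ :=
  fun x => if x = n then j else if x = j then n else f x

/-- As `j` is the last defect, the new arc from `j` to `n` covers no defect, and no old arc covers
`j`. -/
theorem isHalf_joinPoints {n j : ℕ} {f : ℕ → ℕ} (hf : IsHalf n f) (hjn : j < n) (hj : f j = j)
    (hlast : ∀ x, j < x → x < n → f x ≠ x) : IsHalf (n + 1) (joinPoints f j n) := by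
  have hfn := hf.fix n le_rfl
  refine ⟨fun x => ?_, fun x hx => ?_, fun x y hxy hy => ?_⟩
  · have h1 := hf.invol x
    have h2 : f x = n → x = n := fun h => by rw [← h1, h, hfn]
    have h3 : f x = j → x = j := fun h => by rw [← h1, h, hj]
    unfold joinPoints
    split_ifs <;> omega
  · have := hf.fix x (by omega)
    unfold joinPoints
    split_ifs <;> omega
  · have h1 := hf.nested x y hxy
    have h2 : f y = n → y = n := fun h => by rw [← hf.invol y, h, hfn]
    have h3 : f y = j → y = j := fun h => by rw [← hf.invol y, h, hj]
    have h4 := hlast y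
    have h5 : x < n → f x < n := hf.lt
    have h6 : y < n → f y < n := hf.lt
    have h7 := hf.fix x
    have h8 : y = j → f y = y := fun h => by rw [h, hj]
    have h9 : x = j → f x = x := fun h => by rw [h, hj]
    -- For x = j this excludes an old arc that ends at y and starts to the left of j: the defect j
    -- would lie below it.
    have h10 := hf.nested (f y) x
    rw [hf.invol y] at h10
    unfold joinPoints at hy ⊢
    split_ifs at hy ⊢ <;> omega

theorem defects_joinPoints {n j : ℕ} {f : ℕ → ℕ} (hjn : j < n) (hj : f j = j) :
    defects (joinPoints f j n) (n + 1) + 1 = defects f n := by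
  rw [defects_eq_card, defects_eq_card,
    show {x ∈ Finset.range (n + 1) | joinPoints f j n x = x} =
      {x ∈ Finset.range n | f x = x}.erase j by
    ext x
    rw [Finset.mem_erase, Finset.mem_filter, Finset.mem_filter, Finset.mem_range, Finset.mem_range]
    unfold joinPoints
    split_ifs <;> omega]
  exact Finset.card_erase_add_one (by simp [hjn, hj])

theorem exists_last_defect {n : ℕ} {f : ℕ → ℕ} (h : 0 < defects f n) :
    ∃ j < n, f j = j ∧ ∀ x, j < x → x < n → f x ≠ x := by
  obtain ⟨j, h1, h2, h3⟩ := exists_defect (show defects f n - 1 < defects f n by omega)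
  refine ⟨j, h1, h2, fun x h4 h5 h6 => ?_⟩
  have := defects_lt h2 h4
  have := defects_lt h6 h5
  omega

theorem exists_join {n k : ℕ} (b : Half n (k + 1)) : ∃ c : Half (n + 1) k, ∃ j < n,
    b.1 j = j ∧ (∀ x, j < x → x < n → b.1 x ≠ x) ∧ c.1 = joinPoints b.1 j n := by
  obtain ⟨j, h1, h2, h3⟩ := exists_last_defect (f := b.1) (n := n) (by rw [b.2.2]; omega)
  have := defects_joinPoints h1 h2
  rw [b.2.2] at this
  exact ⟨⟨_, isHalf_joinPoints b.2.1 h1 h2 h3, by omega⟩, j, h1, h2, h3, rfl⟩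

/-- Joining the last through end to a new point on the right. -/
noncomputable def Half.join {n k : ℕ} (b : Half n (k + 1)) : Half (n + 1) k := (exists_join b).choose

theorem Half.join_spec {n k : ℕ} (b : Half n (k + 1)) : ∃ j < n,
    b.1 j = j ∧ (∀ x, j < x → x < n → b.1 x ≠ x) ∧ b.join.1 = joinPoints b.1 j n :=
  (exists_join b).choose_spec

theorem Half.join_apply_ne {n k : ℕ} (b : Half n (k + 1)) : b.join.1 n ≠ n := by
  obtain ⟨j, h1, -, -, h2⟩ := b.join_spec
  rw [h2, joinPoints, if_pos rfl]
  omega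

theorem Half.join_injective {n k : ℕ} : Function.Injective (Half.join (n := n) (k := k)) := by
  intro b c h
  obtain ⟨j, h1, h2, -, h3⟩ := b.join_spec
  obtain ⟨i, h4, h5, -, h6⟩ := c.join_spec
  rw [h, h6] at h3
  have h7 : i = j := by simpa [joinPoints] using congrFun h3 n
  subst h7
  apply Subtype.ext
  funext x
  have h8 := congrFun h3 x
  have h9 := b.2.1.fix n le_rfl
  have h10 := c.2.1.fix n le_rfl
  simp only [joinPoints] at h8
  split_ifs at h8 with h11 h12
  · rw [h11, h9, h10]
  · rw [h12, h2, h5]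
  · exact h8.symm

/-- Cutting the arc that ends at `n` frees its left end, which becomes the last defect because
everything below an arc is matched. -/
theorem Half.exists_join_eq {n k : ℕ} (c : Half (n + 1) k) (hn : c.1 n ≠ n) :
    ∃ b : Half n (k + 1), b.join = c := by
  obtain ⟨g, hg, hk⟩ := c
  change g n ≠ n at hn
  have hjn : g n < n := by
    have := hg.lt (Nat.lt_succ_self n)
    omega
  have hgg := hg.invol n
  let f : ℕ → ℕ := fun x => if x = n then n else if x = g n then g n else g x
  have hfj : f (g n) = g n := by simp [f, hn]
  have hfg : joinPoints f (g n) n = g := by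
    funext x
    simp only [joinPoints, f]
    split_ifs with h1 h2
    · rw [h1]
    · rw [h2, hgg]
    · rfl
  have hlast : ∀ x, g n < x → x < n → f x ≠ x := by
    intro x h1 h2
    have := hg.nested (g n) x h1 (by rwa [hgg])
    simp only [f]
    split_ifs <;> omega
  have hf : IsHalf n f := by
    refine ⟨fun x => ?_, fun x hx => ?_, fun x y hxy hy => ?_⟩
    · have h1 := hg.invol x
      have h2 : g x = n → x = g n := fun h => by rw [← h1, h]
      have h3 : g x = g n → x = n := fun h => by rw [← h1, h, hgg]
      simp only [f]
      split_ifs <;> omega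
    · have := hg.fix x
      simp only [f]
      split_ifs <;> omega
    · have h1 := hg.nested x y hxy
      have h2 := hg.nested x (g n)
      have h3 : x < n + 1 → g x < n + 1 := hg.lt
      have h4 : n + 1 ≤ x → g x = x := hg.fix x
      have h5 : g y = n → y = g n := fun h => by rw [← hg.invol y, h]
      have h6 : g y = g n → y = n := fun h => by rw [← hg.invol y, h, hgg]
      simp only [f] at hy ⊢
      split_ifs at hy ⊢ <;> omega
  have hd : defects f n = k + 1 := by
    rw [← defects_joinPoints hjn hfj, hfg, hk]
  refine ⟨⟨f, hf, hd⟩, ?_⟩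
  obtain ⟨j, h1, h2, h3, h4⟩ := Half.join_spec ⟨f, hf, hd⟩
  -- The point used by `Half.join` is only known through its properties; it is `g n` since both are
  -- the last defect of `f`.
  have hj : j = g n := by
    rcases lt_trichotomy j (g n) with h | h | h
    · exact (h3 _ h hjn hfj).elim
    · exact h
    · exact (hlast _ h h1 h2).elim
  apply Subtype.ext
  rw [h4, hj]
  exact hfg

/-- The recursion for half diagrams, by the rightmost point. -/
theorem bijective_half_succ (n k : ℕ) : Function.Bijective
    (Sum.elim Half.addThrough Half.join : Half n k ⊕ Half n (k + 2) → Half (n + 1) (k + 1)) := by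
  have hb : ∀ b : Half n k, b.addThrough.1 n = n := fun b => b.2.1.fix n le_rfl
  refine ⟨?_, fun c => ?_⟩
  · rintro (b | b) (c | c) h
    · replace h : b.addThrough = c.addThrough := h
      exact congrArg _ (Subtype.ext (show b.addThrough.1 = c.addThrough.1 from congrArg Subtype.val h))
    · replace h : b.addThrough = c.join := h
      exact (c.join_apply_ne (h ▸ hb b)).elim
    · replace h : b.join = c.addThrough := h
      exact (b.join_apply_ne (h ▸ hb c)).elim
    · exact congrArg _ (Half.join_injective h)
  · by_cases hn : c.1 n = n
    · refine ⟨Sum.inl ⟨c.1, ⟨c.2.1.invol, fun x hx => ?_, c.2.1.nested⟩, ?_⟩, Subtype.ext rfl⟩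
      · rcases hx.eq_or_lt with rfl | h
        · exact hn
        · exact c.2.1.fix x h
      · have := c.2.2
        rw [defects_succ, if_pos hn] at this
        omega
    · obtain ⟨b, hb⟩ := c.exists_join_eq hn
      exact ⟨Sum.inr b, hb⟩

/-- Without defects the last point must end an arc, so adding a through end does not occur. -/
theorem bijective_half_zero (n : ℕ) : Function.Bijective (Half.join : Half n 1 → Half (n + 1) 0) := by
  refine ⟨Half.join_injective, fun c => c.exists_join_eq fun hn => ?_⟩
  have := c.2.2
  rw [defects_succ, if_pos hn] at this
  omega

/-- Finiteness joins the induction because `Nat.card_sum` needs it, and functions on all of ℕ do not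
provide it by themselves. -/
theorem finite_half_and_card (n k : ℕ) : Finite (Half n k) ∧ Nat.card (Half n k) = ballot n k := by
  induction n generalizing k with
  | zero =>
    cases k with
    | zero =>
      have : Unique (Half 0 0) :=
        { default := ⟨fun x => x, ⟨fun _ => rfl, fun _ _ => rfl, by omega⟩, rfl⟩
          uniq := fun b => Subtype.ext (funext fun x => b.2.1.fix x (Nat.zero_le x)) }
      exact ⟨inferInstance, Nat.card_unique⟩
    | succ k =>
      have : IsEmpty (Half 0 (k + 1)) := ⟨fun b => by
        have := b.2.2
        have := defects_le b.1 0
        omega⟩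
      exact ⟨inferInstance, Nat.card_of_isEmpty⟩
  | succ n ih =>
    cases k with
    | zero =>
      have := (ih 1).1
      let e := Equiv.ofBijective _ (bijective_half_zero n)
      exact ⟨Finite.of_equiv _ e, by rw [← Nat.card_congr e, (ih 1).2, ballot]⟩
    | succ k =>
      have := (ih k).1
      have := (ih (k + 2)).1
      let e := Equiv.ofBijective _ (bijective_half_succ n k)
      exact ⟨Finite.of_equiv _ e, by
        rw [← Nat.card_congr e, Nat.card_sum, (ih k).2, (ih (k + 2)).2, ballot]⟩

/-- The parity of k is read off from the count, which is nonzero as soon as one half diagram exists.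
-/
theorem Half.exists_eq_add {n k : ℕ} (b : Half n k) : ∃ c, n = k + 2 * c := by
  obtain ⟨h1, h2⟩ := finite_half_and_card n k
  apply exists_of_ballot_ne_zero
  rw [← h2]
  have : Nonempty (Half n k) := ⟨b⟩
  exact Nat.card_pos.ne'

/-! ### Inclusions between half diagrams -/

/-- The half diagram with `k` through ends on the left, followed by `c` adjacent arcs. -/
def Half.std (k c : ℕ) : Half (k + 2 * c) k :=
  ⟨fun x => if x < k ∨ k + 2 * c ≤ x then x else if (x - k) % 2 = 0 then x + 1 else x - 1, by
    refine ⟨fun x => ?_, fun x hx => if_pos (Or.inr hx), fun x y hxy hy => ?_⟩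
    · split_ifs <;> omega
    · split_ifs at hy ⊢ <;> omega, by
    rw [defects, Nat.count_add, Nat.count_of_forall, Nat.count_of_forall_not, add_zero]
    · intro x hx
      split_ifs <;> omega
    · intro x hx
      exact if_pos (Or.inl hx)⟩

/-- As k and l have the same parity and l ≤ k, each adjacent arc of `Half.std k c` is also an arc of
`Half.std l d`. -/
theorem exists_half_pair {n k l c d : ℕ} (hk : n = k + 2 * c) (hl : n = l + 2 * d) (h : l ≤ k) :
    ∃ (b : Half n k) (b' : Half n l), b.rel ≤ b'.rel := by
  subst hk
  have h1 : ∃ b' : Half (k + 2 * c) l, (Half.std k c).rel ≤ b'.rel := by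
    -- The transport only adjusts the number of points; by `hb'` the underlying function is
    -- unchanged.
    let b' : Half (k + 2 * c) l := hl ▸ Half.std l d
    have hb' : b'.1 = (Half.std l d).1 := by
      have : ∀ (m : ℕ) (e : m = l + 2 * d), (e ▸ Half.std l d : Half m l).1 = (Half.std l d).1 := by
        rintro m rfl
        rfl
      exact this _ hl
    refine ⟨b', fun i j hij => ?_⟩
    rw [Half.rel_iff] at hij ⊢
    rw [hb']
    simp only [Half.std] at hij ⊢
    split_ifs at hij ⊢ <;> omega
  obtain ⟨b', hb'⟩ := h1
  exact ⟨_, b', hb'⟩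

theorem Half.defects_of_rel_le {n k l : ℕ} {b : Half n k} {c : Half n l} (h : b.rel ≤ c.rel) :
    ∀ x < n, c.1 x = x → b.1 x = x := by
  intro x hx hc
  have h1 : c.rel ⟨x, hx⟩ ⟨b.1 x, b.2.1.lt hx⟩ := h ((b.rel_iff _ _).2 (Or.inr rfl))
  rw [c.rel_iff] at h1
  simpa [hc] using h1

theorem Half.le_of_rel_le {n k l : ℕ} {b : Half n k} {c : Half n l} (h : b.rel ≤ c.rel) :
    l ≤ k := by
  rw [← b.2.2, ← c.2.2]
  exact Nat.count_mono_left (Half.defects_of_rel_le h)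

/-- Enlarging the relation can only turn defects into ends of arcs. With equally many defects none
is lost, so the defects and then the arcs coincide. -/
theorem Half.eq_of_rel_le {n k : ℕ} {b c : Half n k} (h : b.rel ≤ c.rel) : b = c := by
  have h1 := Half.defects_of_rel_le h
  have h2 : {x ∈ Finset.range n | c.1 x = x} = {x ∈ Finset.range n | b.1 x = x} := by
    apply Finset.eq_of_subset_of_card_le
    · intro x
      simp only [Finset.mem_filter, Finset.mem_range]
      exact fun hx => ⟨hx.1, h1 x hx.1 hx.2⟩
    · rw [← defects_eq_card, ← defects_eq_card, b.2.2, c.2.2]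
  apply Subtype.ext
  funext x
  rcases lt_or_ge x n with hx | hx
  · by_cases hb : b.1 x = x
    · have : x ∈ {x ∈ Finset.range n | b.1 x = x} := by simp [hx, hb]
      rw [← h2, Finset.mem_filter] at this
      rw [hb, this.2]
    · have h3 : c.rel ⟨x, hx⟩ ⟨b.1 x, b.2.1.lt hx⟩ := h ((b.rel_iff _ _).2 (Or.inr rfl))
      rw [c.rel_iff] at h3
      exact h3.resolve_left hb
  · rw [b.2.1.fix x hx, c.2.1.fix x hx]

theorem Half.rel_injective {n k : ℕ} {b c : Half n k} (h : b.rel = c.rel) : b = c :=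
  Half.eq_of_rel_le h.le

/-! ### Halves and through strands of products -/

theorem bottomHalf_le_comp {n : ℕ} (a b : Diagram n) : b.bottomHalf ≤ (a.comp b).bottomHalf :=
  fun _ _ h => le_sup_left (b := a.rel.map upper) (map_mk lower h)

theorem topHalf_le_comp {n : ℕ} (a b : Diagram n) : a.topHalf ≤ (a.comp b).topHalf :=
  fun _ _ h => le_sup_right (a := b.rel.map lower) (map_mk upper h)

theorem through_le_of_bottomHalf_le {n : ℕ} {a b : Diagram n} (h : a.bottomHalf ≤ b.bottomHalf) :
    b.through ≤ a.through := by
  obtain ⟨k, b₁, t₁, rfl⟩ := exists_eq_ofHalves a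
  obtain ⟨l, b₂, t₂, rfl⟩ := exists_eq_ofHalves b
  rw [through_ofHalves, through_ofHalves]
  exact Half.le_of_rel_le h

theorem through_le_of_topHalf_le {n : ℕ} {a b : Diagram n} (h : a.topHalf ≤ b.topHalf) :
    b.through ≤ a.through := by
  obtain ⟨k, b₁, t₁, rfl⟩ := exists_eq_ofHalves a
  obtain ⟨l, b₂, t₂, rfl⟩ := exists_eq_ofHalves b
  rw [topHalf_ofHalves, topHalf_ofHalves] at h
  rw [through_ofHalves, through_ofHalves]
  exact Half.le_of_rel_le h

theorem bottomHalf_eq_of_le {n : ℕ} {a b : Diagram n} (h : a.bottomHalf ≤ b.bottomHalf)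
    (hk : a.through ≤ b.through) : a.bottomHalf = b.bottomHalf := by
  have h1 := through_le_of_bottomHalf_le h
  obtain ⟨k, b₁, t₁, rfl⟩ := exists_eq_ofHalves a
  obtain ⟨l, b₂, t₂, rfl⟩ := exists_eq_ofHalves b
  rw [through_ofHalves, through_ofHalves] at h1 hk
  obtain rfl := le_antisymm hk h1
  rw [bottomHalf_ofHalves, bottomHalf_ofHalves] at h ⊢
  rw [Half.eq_of_rel_le h]

theorem topHalf_eq_of_le {n : ℕ} {a b : Diagram n} (h : a.topHalf ≤ b.topHalf)
    (hk : a.through ≤ b.through) : a.topHalf = b.topHalf := by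
  have h1 := through_le_of_topHalf_le h
  obtain ⟨k, b₁, t₁, rfl⟩ := exists_eq_ofHalves a
  obtain ⟨l, b₂, t₂, rfl⟩ := exists_eq_ofHalves b
  rw [through_ofHalves, through_ofHalves] at h1 hk
  obtain rfl := le_antisymm hk h1
  rw [topHalf_ofHalves, topHalf_ofHalves] at h ⊢
  rw [Half.eq_of_rel_le h]

/-- The multiplier has the top half of `a` below and that of `b` above, so that equal halves meet in
the middle. -/
theorem exists_comp_left {n : ℕ} {a b : Diagram n} (h : a.bottomHalf = b.bottomHalf) :
    ∃ c : Diagram n, b = c.comp a := by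
  have h1 := through_le_of_bottomHalf_le h.le
  have h2 := through_le_of_bottomHalf_le h.ge
  obtain ⟨k, b₁, t₁, rfl⟩ := exists_eq_ofHalves a
  obtain ⟨l, b₂, t₂, rfl⟩ := exists_eq_ofHalves b
  rw [through_ofHalves, through_ofHalves] at h1 h2
  obtain rfl := le_antisymm h2 h1
  rw [bottomHalf_ofHalves, bottomHalf_ofHalves] at h
  obtain rfl := Half.rel_injective h
  exact ⟨_, (comp_ofHalves b₁ t₁ t₂).symm⟩

theorem exists_comp_right {n : ℕ} {a b : Diagram n} (h : a.topHalf = b.topHalf) :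
    ∃ c : Diagram n, b = a.comp c := by
  have h1 := through_le_of_topHalf_le h.le
  have h2 := through_le_of_topHalf_le h.ge
  obtain ⟨k, b₁, t₁, rfl⟩ := exists_eq_ofHalves a
  obtain ⟨l, b₂, t₂, rfl⟩ := exists_eq_ofHalves b
  rw [through_ofHalves, through_ofHalves] at h1 h2
  obtain rfl := le_antisymm h2 h1
  rw [topHalf_ofHalves, topHalf_ofHalves] at h
  obtain rfl := Half.rel_injective h
  exact ⟨_, (comp_ofHalves b₂ b₁ t₁).symm⟩

theorem Diagram.eq_of_halves {n : ℕ} {a b : Diagram n} (h : a.bottomHalf = b.bottomHalf)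
    (h' : a.topHalf = b.topHalf) : a = b := by
  have h1 := through_le_of_bottomHalf_le h.le
  have h2 := through_le_of_bottomHalf_le h.ge
  obtain ⟨k, b₁, t₁, rfl⟩ := exists_eq_ofHalves a
  obtain ⟨l, b₂, t₂, rfl⟩ := exists_eq_ofHalves b
  rw [through_ofHalves, through_ofHalves] at h1 h2
  obtain rfl := le_antisymm h2 h1
  rw [bottomHalf_ofHalves, bottomHalf_ofHalves] at h
  rw [topHalf_ofHalves, topHalf_ofHalves] at h'
  rw [Half.rel_injective h, Half.rel_injective h']

/-- Take half diagrams `s` ≤ `s'` with as many defects as `a` and `b` respectively. Multiplication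
on both sides turns `a` into the diagram with both halves `s`, which is absorbed by the one with
both halves `s'`; the outermost factors then replace these by the halves of `b`. -/
theorem exists_comp_both {n : ℕ} {a b : Diagram n} (h : b.through ≤ a.through) :
    ∃ c d : Diagram n, b = (c.comp a).comp d := by
  obtain ⟨k, b₁, t₁, rfl⟩ := exists_eq_ofHalves a
  obtain ⟨l, b₂, t₂, rfl⟩ := exists_eq_ofHalves b
  rw [through_ofHalves, through_ofHalves] at h
  obtain ⟨p, hp⟩ := b₁.exists_eq_add
  obtain ⟨q, hq⟩ := b₂.exists_eq_add
  obtain ⟨s, s', hs⟩ := exists_half_pair hp hq h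
  refine ⟨((Diagram.ofHalves s' t₂).comp (Diagram.ofHalves s' s')).comp (Diagram.ofHalves t₁ s),
    (Diagram.ofHalves s b₁).comp (Diagram.ofHalves b₂ s'), ?_⟩
  have assoc : ∀ x y z : Diagram n, (x.comp y).comp z = x.comp (y.comp z) := fun x y z =>
    (glue_three x y z).1
  simp only [assoc]
  rw [← assoc (.ofHalves b₁ t₁), comp_ofHalves, ← assoc (.ofHalves t₁ s), comp_ofHalves,
    ← assoc (.ofHalves s' s'), comp_ofHalves_of_le s s' hs, comp_ofHalves, comp_ofHalves]

/-! ### The cell structure of the cyclic monoid -/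

section Orders

variable {m n : ℕ}

theorem skeleton_mul (x y : CyclicTL m n) : (x * y).skeleton = x.skeleton.comp y.skeleton := rfl

theorem internal_mul (x y : CyclicTL m n) :
    (x * y).internal = x.internal + y.internal + (Phi x.skeleton y.skeleton : ZMod m) := rfl

/-- Since the internal counts form a group, the count of the multiplier can be chosen to produce any
required result. Only the skeletons matter, whatever m is. -/
theorem leftLE_iff (x y : CyclicTL m n) :
    LeftLE x y ↔ ∃ c : Diagram n, y.skeleton = c.comp x.skeleton := by
  constructor
  · rintro ⟨c, rfl⟩
    exact ⟨c.skeleton, rfl⟩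
  · rintro ⟨c, hc⟩
    refine ⟨⟨c, y.internal - x.internal - (Phi c x.skeleton : ZMod m)⟩, CyclicTL.ext hc ?_⟩
    rw [internal_mul]
    ring

theorem rightLE_iff (x y : CyclicTL m n) :
    RightLE x y ↔ ∃ c : Diagram n, y.skeleton = x.skeleton.comp c := by
  constructor
  · rintro ⟨c, rfl⟩
    exact ⟨c.skeleton, rfl⟩
  · rintro ⟨c, hc⟩
    refine ⟨⟨c, y.internal - x.internal - (Phi x.skeleton c : ZMod m)⟩, CyclicTL.ext hc ?_⟩
    rw [internal_mul]
    ring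

theorem twoSidedLE_iff (x y : CyclicTL m n) :
    TwoSidedLE x y ↔ ∃ c d : Diagram n, y.skeleton = (c.comp x.skeleton).comp d := by
  constructor
  · rintro ⟨c, d, rfl⟩
    exact ⟨c.skeleton, d.skeleton, rfl⟩
  · rintro ⟨c, d, h⟩
    refine ⟨⟨c, 0⟩, ⟨d, y.internal - x.internal - (Phi c x.skeleton : ZMod m) -
      (Phi (c.comp x.skeleton) d : ZMod m)⟩, CyclicTL.ext h ?_⟩
    rw [internal_mul, internal_mul, skeleton_mul]
    ring

theorem LeftLE.bottomHalf_le {x y : CyclicTL m n} (h : LeftLE x y) :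
    x.skeleton.bottomHalf ≤ y.skeleton.bottomHalf := by
  obtain ⟨c, rfl⟩ := h
  exact bottomHalf_le_comp _ _

theorem RightLE.topHalf_le {x y : CyclicTL m n} (h : RightLE x y) :
    x.skeleton.topHalf ≤ y.skeleton.topHalf := by
  obtain ⟨c, rfl⟩ := h
  exact topHalf_le_comp _ _

theorem leftLE_of_bottomHalf_eq {x y : CyclicTL m n}
    (h : x.skeleton.bottomHalf = y.skeleton.bottomHalf) : LeftLE x y :=
  (leftLE_iff x y).2 (exists_comp_left h)

theorem rightLE_of_topHalf_eq {x y : CyclicTL m n}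
    (h : x.skeleton.topHalf = y.skeleton.topHalf) : RightLE x y :=
  (rightLE_iff x y).2 (exists_comp_right h)

theorem leftEquiv_iff (x y : CyclicTL m n) :
    LeftEquiv x y ↔ x.skeleton.bottomHalf = y.skeleton.bottomHalf :=
  ⟨fun h => le_antisymm h.1.bottomHalf_le h.2.bottomHalf_le,
    fun h => ⟨leftLE_of_bottomHalf_eq h, leftLE_of_bottomHalf_eq h.symm⟩⟩

theorem rightEquiv_iff (x y : CyclicTL m n) :
    RightEquiv x y ↔ x.skeleton.topHalf = y.skeleton.topHalf :=
  ⟨fun h => le_antisymm h.1.topHalf_le h.2.topHalf_le,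
    fun h => ⟨rightLE_of_topHalf_eq h, rightLE_of_topHalf_eq h.symm⟩⟩

theorem LeftLE.through_le {x y : CyclicTL m n} (h : LeftLE x y) :
    y.skeleton.through ≤ x.skeleton.through :=
  through_le_of_bottomHalf_le h.bottomHalf_le

theorem RightLE.through_le {x y : CyclicTL m n} (h : RightLE x y) :
    y.skeleton.through ≤ x.skeleton.through :=
  through_le_of_topHalf_le h.topHalf_le

/-- If no through strand is lost, the included bottom half is the whole bottom half, and then the
relation can be reversed. -/
theorem LeftLE.through_lt {x y : CyclicTL m n} (h : LeftLE x y) (h' : ¬ LeftLE y x) :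
    y.skeleton.through < x.skeleton.through := by
  by_contra h1
  exact h' (leftLE_of_bottomHalf_eq (bottomHalf_eq_of_le h.bottomHalf_le (not_lt.1 h1)).symm)

theorem RightLE.through_lt {x y : CyclicTL m n} (h : RightLE x y) (h' : ¬ RightLE y x) :
    y.skeleton.through < x.skeleton.through := by
  by_contra h1
  exact h' (rightLE_of_topHalf_eq (topHalf_eq_of_le h.topHalf_le (not_lt.1 h1)).symm)

theorem twoSidedLE_iff_through (x y : CyclicTL m n) :
    TwoSidedLE x y ↔ y.skeleton.through ≤ x.skeleton.through := by
  constructor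
  · rintro ⟨c, d, rfl⟩
    exact (RightLE.through_le ⟨d, rfl⟩).trans (LeftLE.through_le ⟨c, rfl⟩)
  · intro h
    exact (twoSidedLE_iff x y).2 (exists_comp_both h)

theorem twoSidedEquiv_iff (x y : CyclicTL m n) :
    TwoSidedEquiv x y ↔ y.skeleton.through = x.skeleton.through := by
  rw [TwoSidedEquiv, twoSidedLE_iff_through, twoSidedLE_iff_through]
  exact ⟨fun h => le_antisymm h.1 h.2, fun h => ⟨h.le, h.ge⟩⟩

theorem exists_eq_add_of_modEq {k : ℕ} (h : k ≤ n) (h' : k ≡ n [MOD 2]) :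
    n = k + 2 * capNumber n k := by
  have := Nat.ModEq.symm h'
  unfold Nat.ModEq at this
  unfold capNumber
  omega

theorem nonempty_half {k : ℕ} (h : k ≤ n) (h' : k ≡ n [MOD 2]) : Nonempty (Half n k) := by
  have h1 := exists_eq_add_of_modEq h h'
  obtain ⟨b, -⟩ := exists_half_pair h1 h1 le_rfl
  exact ⟨b⟩

theorem through_le_and_modEq (d : Diagram n) : d.through ≤ n ∧ d.through ≡ n [MOD 2] := by
  obtain ⟨k, b, t, rfl⟩ := exists_eq_ofHalves d
  rw [through_ofHalves]
  obtain ⟨c, hc⟩ := b.exists_eq_add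
  refine ⟨by omega, ?_⟩
  unfold Nat.ModEq
  omega

theorem isJCell_iff (J : Set (CyclicTL m n)) :
    IsJCell J ↔ ∃ k, k ≤ n ∧ k ≡ n [MOD 2] ∧ J = throughClass m n k := by
  constructor
  · rintro ⟨x, rfl⟩
    refine ⟨x.skeleton.through, (through_le_and_modEq _).1, (through_le_and_modEq _).2, ?_⟩
    ext y
    exact twoSidedEquiv_iff x y
  · rintro ⟨k, h1, h2, rfl⟩
    obtain ⟨b⟩ := nonempty_half h1 h2
    refine ⟨⟨Diagram.ofHalves b b, 0⟩, ?_⟩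
    ext y
    refine Iff.trans ?_ (twoSidedEquiv_iff _ y).symm
    rw [through_ofHalves]
    exact Iff.rfl

theorem isLinearOrder_jCellLE :
    IsLinearOrder {J : Set (CyclicTL m n) // IsJCell J} JCellLE := by
  -- Nonemptiness matters because `JCellLE` quantifies over all pairs of elements and would hold
  -- vacuously for an empty class.
  have key : ∀ J : {J : Set (CyclicTL m n) // IsJCell J}, ∃ k, J.1.Nonempty ∧
      J.1 = throughClass m n k := by
    rintro ⟨J, x, rfl⟩
    exact ⟨x.skeleton.through, ⟨x, (twoSidedEquiv_iff x x).2 rfl⟩,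
      Set.ext fun y => twoSidedEquiv_iff x y⟩
  choose κ hne hκ using key
  have hle : ∀ J K, JCellLE J K ↔ κ K ≤ κ J := by
    intro J K
    constructor
    · intro h
      obtain ⟨a, ha⟩ := hne J
      obtain ⟨b, hb⟩ := hne K
      have h1 := (twoSidedLE_iff_through a b).1 (h a ha b hb)
      rw [hκ] at ha hb
      rwa [show a.skeleton.through = κ J from ha, show b.skeleton.through = κ K from hb] at h1
    · intro h a ha b hb
      rw [hκ] at ha hb
      rw [twoSidedLE_iff_through, show a.skeleton.through = κ J from ha,
        show b.skeleton.through = κ K from hb]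
      exact h
  exact
    { refl := fun J => (hle J J).2 le_rfl
      trans := fun J K L h h' => (hle J L).2 (((hle K L).1 h').trans ((hle J K).1 h))
      antisymm := fun J K h h' => Subtype.ext (by
        rw [hκ J, hκ K, le_antisymm ((hle K J).1 h') ((hle J K).1 h)])
      total := fun J K => by
        rw [hle, hle]
        exact le_total _ _ }

/-- The left cell fixes the bottom half and the right cell the top half; together they determine the
skeleton and leave the internal count free. -/
theorem isHCell_iff (H : Set (CyclicTL m n)) :
    IsHCell H ↔ ∃ d : Diagram n, H = {x | x.skeleton = d} := by
  have key : ∀ z y : CyclicTL m n,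
      LeftEquiv z y ∧ RightEquiv z y ↔ y.skeleton = z.skeleton := by
    intro z y
    rw [leftEquiv_iff, rightEquiv_iff]
    constructor
    · rintro ⟨h, h'⟩
      exact Diagram.eq_of_halves h.symm h'.symm
    · intro h
      rw [h]
      exact ⟨rfl, rfl⟩
  constructor
  · rintro ⟨⟨z, hz⟩, L, R, ⟨x, rfl⟩, ⟨y, rfl⟩, rfl⟩
    refine ⟨z.skeleton, ?_⟩
    ext w
    refine Iff.trans ?_ (key z w)
    have h1 := (leftEquiv_iff _ _).1 hz.1
    have h2 := (rightEquiv_iff _ _).1 hz.2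
    change LeftEquiv x w ∧ RightEquiv y w ↔ _
    rw [leftEquiv_iff, leftEquiv_iff, rightEquiv_iff, rightEquiv_iff, h1, h2]
  · rintro ⟨d, rfl⟩
    exact ⟨⟨⟨d, 0⟩, rfl⟩, _, _, ⟨⟨d, 0⟩, rfl⟩, ⟨⟨d, 0⟩, rfl⟩,
      Set.ext fun w => (key ⟨d, 0⟩ w).symm⟩

theorem ncard_fiber (d : Diagram n) : {x : CyclicTL m n | x.skeleton = d}.ncard = m := by
  let e : ZMod m ≃ {x : CyclicTL m n | x.skeleton = d} :=
    { toFun := fun i => ⟨⟨d, i⟩, rfl⟩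
      invFun := fun x => x.1.internal
      left_inv := fun _ => rfl
      right_inv := fun x => Subtype.ext (CyclicTL.ext x.2.symm rfl) }
  rw [← Nat.card_coe_set_eq, ← Nat.card_congr e, Nat.card_zmod]

/-- With the bottom half fixed, an element is a free choice of a top half with k defects and of an
internal count. -/
theorem ncard_isLeftCell {k : ℕ} {L : Set (CyclicTL m n)} (hL : IsLeftCell L)
    (hk : L ⊆ throughClass m n k) : L.ncard = ballot n k * m := by
  obtain ⟨x, rfl⟩ := hL
  have hx : x.skeleton.through = k := hk ((leftEquiv_iff x x).2 rfl)
  obtain ⟨l, b, t, hbt⟩ := exists_eq_ofHalves x.skeleton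
  rw [hbt, through_ofHalves] at hx
  subst hx
  let f : Half n l × ZMod m → {y | LeftEquiv x y} := fun p =>
    ⟨⟨Diagram.ofHalves b p.1, p.2⟩, (leftEquiv_iff _ _).2 (by rw [hbt]; rfl)⟩
  have hf : Function.Bijective f := by
    constructor
    · rintro ⟨u, i⟩ ⟨v, j⟩ h
      have h1 := CyclicTL.ext_iff.1 (Subtype.ext_iff.1 h)
      have h2 : (Diagram.ofHalves b u).topHalf = (Diagram.ofHalves b v).topHalf :=
        congrArg _ h1.1
      rw [topHalf_ofHalves, topHalf_ofHalves] at h2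
      exact Prod.ext (Half.rel_injective h2) h1.2
    · rintro ⟨y, hy⟩
      have h1 : y.skeleton.through = l := hk hy
      have h2 := (leftEquiv_iff x y).1 hy
      obtain ⟨l', b', t', hbt'⟩ := exists_eq_ofHalves y.skeleton
      rw [hbt', through_ofHalves] at h1
      subst h1
      rw [hbt, hbt', bottomHalf_ofHalves, bottomHalf_ofHalves] at h2
      obtain rfl := Half.rel_injective h2
      exact ⟨⟨t', y.internal⟩, Subtype.ext (CyclicTL.ext hbt'.symm rfl)⟩
  rw [← Nat.card_coe_set_eq, ← Nat.card_congr (Equiv.ofBijective f hf), Nat.card_prod,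
    Nat.card_zmod, (finite_half_and_card n l).2]

theorem ncard_isRightCell {k : ℕ} {R : Set (CyclicTL m n)} (hR : IsRightCell R)
    (hk : R ⊆ throughClass m n k) : R.ncard = ballot n k * m := by
  obtain ⟨x, rfl⟩ := hR
  have hx : x.skeleton.through = k := hk ((rightEquiv_iff x x).2 rfl)
  obtain ⟨l, b, t, hbt⟩ := exists_eq_ofHalves x.skeleton
  rw [hbt, through_ofHalves] at hx
  subst hx
  let f : Half n l × ZMod m → {y | RightEquiv x y} := fun p =>
    ⟨⟨Diagram.ofHalves p.1 t, p.2⟩, (rightEquiv_iff _ _).2 (by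
      rw [hbt, topHalf_ofHalves, topHalf_ofHalves])⟩
  have hf : Function.Bijective f := by
    constructor
    · rintro ⟨u, i⟩ ⟨v, j⟩ h
      have h1 := CyclicTL.ext_iff.1 (Subtype.ext_iff.1 h)
      have h2 : (Diagram.ofHalves u t).bottomHalf = (Diagram.ofHalves v t).bottomHalf :=
        congrArg _ h1.1
      exact Prod.ext (Half.rel_injective h2) h1.2
    · rintro ⟨y, hy⟩
      have h1 : y.skeleton.through = l := hk hy
      have h2 := (rightEquiv_iff x y).1 hy
      obtain ⟨l', b', t', hbt'⟩ := exists_eq_ofHalves y.skeleton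
      rw [hbt', through_ofHalves] at h1
      subst h1
      rw [hbt, hbt', topHalf_ofHalves, topHalf_ofHalves] at h2
      obtain rfl := Half.rel_injective h2
      exact ⟨⟨b', y.internal⟩, Subtype.ext (CyclicTL.ext hbt'.symm rfl)⟩
  rw [← Nat.card_coe_set_eq, ← Nat.card_congr (Equiv.ofBijective f hf), Nat.card_prod,
    Nat.card_zmod, (finite_half_and_card n l).2]

theorem ncard_throughClass (m n k : ℕ) :
    (throughClass m n k).ncard = ballot n k * (ballot n k * m) := by
  let f : Half n k × Half n k × ZMod m → throughClass m n k := fun p =>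
    ⟨⟨Diagram.ofHalves p.1 p.2.1, p.2.2⟩, through_ofHalves _ _⟩
  have hf : Function.Bijective f := by
    constructor
    · rintro ⟨b, t, i⟩ ⟨b', t', j⟩ h
      have h1 := CyclicTL.ext_iff.1 (Subtype.ext_iff.1 h)
      have h2 : (Diagram.ofHalves b t).bottomHalf = (Diagram.ofHalves b' t').bottomHalf :=
        congrArg _ h1.1
      have h3 : (Diagram.ofHalves b t).topHalf = (Diagram.ofHalves b' t').topHalf :=
        congrArg _ h1.1
      rw [topHalf_ofHalves, topHalf_ofHalves] at h3
      exact Prod.ext (Half.rel_injective h2) (Prod.ext (Half.rel_injective h3) h1.2)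
    · rintro ⟨y, hy⟩
      have h1 : y.skeleton.through = k := hy
      obtain ⟨l, b, t, hbt⟩ := exists_eq_ofHalves y.skeleton
      rw [hbt, through_ofHalves] at h1
      subst h1
      exact ⟨⟨b, t, y.internal⟩, Subtype.ext (CyclicTL.ext hbt.symm rfl)⟩
  rw [← Nat.card_coe_set_eq, ← Nat.card_congr (Equiv.ofBijective f hf), Nat.card_prod,
    Nat.card_prod, Nat.card_zmod, (finite_half_and_card n k).2]

theorem ballot_eq {k : ℕ} (h : k ≤ n) (h' : k ≡ n [MOD 2]) :
    (ballot n k : ℚ) =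
      ((k : ℚ) + 1) / ((n : ℚ) - (capNumber n k : ℚ) + 1) * (n.choose (capNumber n k) : ℚ) := by
  have h1 := exists_eq_add_of_modEq h h'
  have h2 := ballot_mul h1
  have h3 : (n : ℚ) - (capNumber n k : ℚ) + 1 = k + capNumber n k + 1 := by
    have : (n : ℚ) = k + 2 * capNumber n k := by exact_mod_cast h1
    rw [this]
    ring
  have h4 : (k : ℚ) + capNumber n k + 1 ≠ 0 := by positivity
  rw [h3, div_mul_eq_mul_div, eq_div_iff h4]
  exact_mod_cast h2

theorem isIdempotentCell_of_isJCell {J : Set (CyclicTL m n)} (hJ : IsJCell J) :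
    IsIdempotentCell J := by
  obtain ⟨k, h1, h2, rfl⟩ := (isJCell_iff J).1 hJ
  obtain ⟨b⟩ := nonempty_half h1 h2
  let d := Diagram.ofHalves b b
  -- The internal count i of an idempotent over `d` has to solve 2i + Φ(d, d) = i.
  refine ⟨⟨d, -(Phi d d : ZMod m)⟩, through_ofHalves b b,
    CyclicTL.ext (comp_ofHalves b b b) ?_⟩
  rw [internal_mul]
  ring

/-- The idempotent ensures that the skeleton is idempotent. The map is only a semigroup
homomorphism, as the identity of the H-cell need not be that of the monoid. -/
theorem exists_mulHom_of_isIdempotentCell {H : Set (CyclicTL m n)} (hH : IsHCell H)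
    (he : IsIdempotentCell H) : ∃ f : Multiplicative (ZMod m) →ₙ* CyclicTL m n,
      Function.Injective f ∧ Set.range f = H := by
  obtain ⟨d, rfl⟩ := (isHCell_iff H).1 hH
  obtain ⟨e, rfl, h⟩ := he
  have hd : e.skeleton.comp e.skeleton = e.skeleton := congrArg CyclicTL.skeleton h
  let φ : ZMod m := (Phi e.skeleton e.skeleton : ℕ)
  -- Each product adds φ to the internal counts; the shift by -φ compensates, since (i - φ) + (j -
  -- φ) + φ = (i + j) - φ.
  refine ⟨⟨fun i => ⟨e.skeleton, i.toAdd - φ⟩, fun i j => CyclicTL.ext hd.symm ?_⟩, ?_, ?_⟩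
  · rw [internal_mul, toAdd_mul]
    change _ = i.toAdd - φ + (j.toAdd - φ) + φ
    ring
  · intro i j hij
    exact Multiplicative.toAdd.injective (sub_left_injective (congrArg CyclicTL.internal hij))
  · ext x
    constructor
    · rintro ⟨i, rfl⟩
      rfl
    · intro hx
      exact ⟨Multiplicative.ofAdd (x.internal + φ), CyclicTL.ext (Eq.symm hx)
        (add_sub_cancel_right x.internal φ)⟩

end Orders

end TemperleyLieb

theorem propositionP (m n : ℕ) (hm : 1 ≤ m) :
    open TemperleyLieb in
    -- the cell structure is that of the Temperley--Lieb monoid, with `H`-cells of size `m`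
    ((∀ x y : CyclicTL m n, LeftLE x y ↔ LeftLE x.toTL y.toTL) ∧
      (∀ x y : CyclicTL m n, RightLE x y ↔ RightLE x.toTL y.toTL) ∧
      (∀ x y : CyclicTL m n, TwoSidedLE x y ↔ TwoSidedLE x.toTL y.toTL) ∧
      (∀ H : Set (CyclicTL m n), IsHCell H ↔ ∃ d : Diagram n, H = {x | x.skeleton = d}) ∧
      (∀ H : Set (CyclicTL m n), IsHCell H → H.ncard = m)) ∧
    -- left and right cells
    ((∀ x y : CyclicTL m n,
        LeftEquiv x y ↔ x.skeleton.bottomHalf = y.skeleton.bottomHalf) ∧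
      (∀ x y : CyclicTL m n,
        RightEquiv x y ↔ x.skeleton.topHalf = y.skeleton.topHalf)) ∧
    -- `J`-cells
    (∀ J : Set (CyclicTL m n),
      IsJCell J ↔ ∃ k, k ≤ n ∧ k ≡ n [MOD 2] ∧ J = throughClass m n k) ∧
    -- the orders
    ((∀ x y : CyclicTL m n, LeftLE x y → y.skeleton.through ≤ x.skeleton.through) ∧
      (∀ x y : CyclicTL m n, LeftLE x y → ¬ LeftLE y x →
        y.skeleton.through < x.skeleton.through) ∧
      (∀ x y : CyclicTL m n, RightLE x y → y.skeleton.through ≤ x.skeleton.through) ∧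
      (∀ x y : CyclicTL m n, RightLE x y → ¬ RightLE y x →
        y.skeleton.through < x.skeleton.through) ∧
      (∀ x y : CyclicTL m n,
        TwoSidedLE x y ↔ y.skeleton.through ≤ x.skeleton.through) ∧
      IsLinearOrder {J : Set (CyclicTL m n) // IsJCell J} JCellLE) ∧
    -- sizes of left and right cells
    (∀ k, k ≤ n → k ≡ n [MOD 2] →
      (∀ L : Set (CyclicTL m n), IsLeftCell L → L ⊆ throughClass m n k →
        (L.ncard : ℚ) = (m : ℚ) * (((k : ℚ) + 1) / ((n : ℚ) - (capNumber n k : ℚ) + 1)) *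
          (n.choose (capNumber n k) : ℚ)) ∧
      (∀ R : Set (CyclicTL m n), IsRightCell R → R ⊆ throughClass m n k →
        (R.ncard : ℚ) = (m : ℚ) * (((k : ℚ) + 1) / ((n : ℚ) - (capNumber n k : ℚ) + 1)) *
          (n.choose (capNumber n k) : ℚ))) ∧
    -- sizes of `J`-cells
    (∀ k, k ≤ n → k ≡ n [MOD 2] →
      ∀ L : Set (CyclicTL m n), IsLeftCell L → L ⊆ throughClass m n k →
        ((throughClass m n k).ncard : ℚ) = (L.ncard : ℚ) ^ 2 / (m : ℚ)) ∧
    -- regularity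
    (∀ J : Set (CyclicTL m n), IsJCell J → IsIdempotentCell J) ∧
    -- idempotent `H`-cells are cyclic groups of order `m` under the multiplication of the monoid
    (∀ H : Set (CyclicTL m n), IsHCell H → IsIdempotentCell H →
      ∃ f : Multiplicative (ZMod m) →ₙ* CyclicTL m n,
        Function.Injective f ∧ Set.range f = H) := by
  open TemperleyLieb in
  refine ⟨⟨fun x y => ?_, fun x y => ?_, fun x y => ?_, isHCell_iff, fun H hH => ?_⟩,
    ⟨leftEquiv_iff, rightEquiv_iff⟩, isJCell_iff,
    ⟨fun _ _ => LeftLE.through_le, fun _ _ => LeftLE.through_lt, fun _ _ => RightLE.through_le,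
      fun _ _ => RightLE.through_lt, twoSidedLE_iff_through, isLinearOrder_jCellLE⟩,
    fun k h h' => ⟨fun L hL hk => ?_, fun R hR hk => ?_⟩, fun k h h' L hL hk => ?_,
    fun _ => isIdempotentCell_of_isJCell, fun _ => exists_mulHom_of_isIdempotentCell⟩
  · rw [leftLE_iff, leftLE_iff]
    exact Iff.rfl
  · rw [rightLE_iff, rightLE_iff]
    exact Iff.rfl
  · rw [twoSidedLE_iff, twoSidedLE_iff]
    exact Iff.rfl
  · obtain ⟨d, rfl⟩ := (isHCell_iff H).1 hH
    exact ncard_fiber d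
  · rw [ncard_isLeftCell hL hk, mul_assoc, ← ballot_eq h h']
    push_cast
    ring
  · rw [ncard_isRightCell hR hk, mul_assoc, ← ballot_eq h h']
    push_cast
    ring
  · have hm' : (m : ℚ) ≠ 0 := by positivity
    rw [ncard_isLeftCell hL hk, ncard_throughClass, eq_div_iff hm']
    push_cast
    ring
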